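/- Notation. For a real $n\times p$ matrix $X$ with columns $x_1,\dots,x_p$ and a linear subspace ${\cal V}\subset\mathbb R^n$ let $\delta({\cal V},X):=\max_{1\le j\le p}\|x_j^{{\cal V}^\perp}\|_2$, where $x_j^{{\cal V}^\perp}$ is the orthogonal projection of $x_j$ on ${\cal V}^\perp$. For $\epsilon>0$ let $M(\epsilon,X)$ be the smallest $N\ge 1$ such that some $N$-dimensional linear subspace ${\cal V}$ has $\delta({\cal V},X)\le\epsilon$. For a subset $T$ of a Euclidean space, $N(\epsilon,T)$ is the smallest number of balls of radius $\epsilon$ that cover $T$, and ${\cal H}(\epsilon,T):=\log N(\epsilon,T)$; $N(\epsilon,X)$ is the covering number of the set of columns of $X$. Finally ${\rm absconv}(X):=\{X\beta:\ \beta\in\mathbb R^p,\ \|\beta\|_1\le 1\}$. Let $d,q\ge 1$ be integers and $\gamma,W>0$. Consider all $m\times r$ real matrices $\Psi=(\psi_1,\dots,\psi_r)$, for arbitrary $m$ and $r$, such that $\max_j\|\psi_j\|_2\le 1$ and such that $\Psi$ has a nested approximation with parameters $(q,\gamma,W)$: there are linear subspaces ${\cal V}_0\subset{\cal V}_1\subset\cdots$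 of $\mathbb R^m$ with $\dim{\cal V}_k\le q2^k$ for all $k\ge 0$ and $\delta({\cal V}_k,\Psi)\le\gamma 2^{-k/W}$ for all $k\ge 1$. Let $X:=\Psi\otimes\cdots\otimes\Psi$ ($d$ factors) be the $d$-fold tensor (Kronecker) power, an $m^d\times r^d$ matrix, and let ${\cal F}:={\rm absconv}(X)\subset\mathbb R^{m^d}$. (a) There are constants $C>0$ and $\epsilon_0\in(0,1)$, depending only on $d,q,\gamma,W$, such that for all such $\Psi$ (in particular for all $m$ and $r$) and all $0<\epsilon\le\epsilon_0$ $$M(\epsilon,X)\le C\,\epsilon^{-W}\log^{\frac{(d-1)(2+W)}{2}}(1/\epsilon).$$ (b) Let in addition $V\in\mathbb R$ and $A,\epsilon_1>0$. There are constants $C>0$ and $\epsilon_0\in(0,1)$, depending only on $d,q,\gamma,W,V,A,\epsilon_1$, such that for all such $\Psi$ that also satisfy $N(\epsilon,\Psi)\le A\,\epsilon^{-V}$ for all $0<\epsilon\le\epsilon_1$, and for all $0<\epsilon\le\epsilon_0$, $$N(\epsilon,X)\le C\,\epsilon^{-dV}$$ and $${\cal H}(\epsilon,{\cal F})\le C\,\epsilon^{-\frac{2W}{2+W}}\,\log^{d-1}(1/\epsilon)\,\log^{\frac{W}{2+W}}(1/\epsilon).$$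 -/

import Mathlib

open scoped NNReal ENNReal

noncomputable section

namespace TensorEntropy

/-- The `j`-th column of a real matrix, as a vector of Euclidean space. -/
def column {ι κ : Type*} [Fintype ι] (X : Matrix ι κ ℝ) (j : κ) : EuclideanSpace ℝ ι :=
  WithLp.toLp 2 (fun i => X i j)

/-- The set of columns of a matrix. -/
def columnSet {ι κ : Type*} [Fintype ι] (X : Matrix ι κ ℝ) : Set (EuclideanSpace ℝ ι) :=
  Set.range (column X)

/-- The `d`-fold tensor (Kronecker) power `Ψ ⊗ ⋯ ⊗ Ψ`. Rows are indexed by `(i₁, …, i_d)`,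
columns by `(j₁, …, j_d)`, and the column of index `(j₁, …, j_d)` is `ψ_{j₁} ⊗ ⋯ ⊗ ψ_{j_d}`. -/
def tensorPower {m r : ℕ} (d : ℕ) (Ψ : Matrix (Fin m) (Fin r) ℝ) :
    Matrix (Fin d → Fin m) (Fin d → Fin r) ℝ :=
  Matrix.of fun i j => ∏ k, Ψ (i k) (j k)

/-- The absolute convex hull `{X β : ‖β‖₁ ≤ 1}` of the columns of `X`. -/
def absconv {ι κ : Type*} [Fintype ι] [Fintype κ] (X : Matrix ι κ ℝ) :
    Set (EuclideanSpace ℝ ι) :=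
  {f | ∃ β : κ → ℝ, ∑ j, |β j| ≤ 1 ∧ f = WithLp.toLp 2 (X.mulVec β)}

/-- `δ(𝒱, X)`: the largest Euclidean norm of the projection of a column of `X` on the
orthocomplement of `𝒱`. -/
def approximationNumber {ι κ : Type*} [Fintype ι] (𝒱 : Submodule ℝ (EuclideanSpace ℝ ι))
    (X : Matrix ι κ ℝ) : ℝ :=
  ⨆ j, ‖𝒱ᗮ.starProjection (column X j)‖

/-- `M(ε, X)`: the smallest positive dimension of a linear subspace `𝒱` with `δ(𝒱, X) ≤ ε`. -/
def epsApproximation {ι κ : Type*} [Fintype ι] (ε : ℝ) (X : Matrix ι κ ℝ) : ℕ :=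
  sInf {N | 1 ≤ N ∧ ∃ 𝒱 : Submodule ℝ (EuclideanSpace ℝ ι),
    Module.finrank ℝ 𝒱 = N ∧ approximationNumber 𝒱 X ≤ ε}

/-- `N(ε, T)`: the smallest number of balls of radius `ε` in the ambient space that cover `T`
(`⊤` if there is no finite cover). -/
def coveringNumber {E : Type*} [PseudoEMetricSpace E] (ε : ℝ) (T : Set E) : ℝ≥0∞ :=
  (Metric.externalCoveringNumber ε.toNNReal T : ℕ∞)

/-- The entropy `H(ε, T) = log N(ε, T)`, as an extended real. -/
def entropy {E : Type*} [PseudoEMetricSpace E] (ε : ℝ) (T : Set E) : EReal :=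
  ENNReal.log (coveringNumber ε T)

/-- `𝒱₀ ⊆ 𝒱₁ ⊆ ⋯` is a nested approximation for `Ψ` with parameters `(q, γ, W)`.
The dimension of `𝒱_k` is at most `q 2^k`; equality for all `k` is impossible in a
finite-dimensional space. -/
structure IsNestedApproximation {m r : ℕ}
    (𝒱 : ℕ → Submodule ℝ (EuclideanSpace ℝ (Fin m)))
    (Ψ : Matrix (Fin m) (Fin r) ℝ) (q : ℕ) (γ W : ℝ) : Prop where
  nested : ∀ k, 𝒱 k ≤ 𝒱 (k + 1)
  finrank_le : ∀ k, Module.finrank ℝ (𝒱 k) ≤ q * 2 ^ k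
  approx : ∀ k : ℕ, 1 ≤ k → approximationNumber (𝒱 k) Ψ ≤ γ * (2 : ℝ) ^ (-(k : ℝ) / W)

end TensorEntropy

end

noncomputable section

namespace TensorEntropy

/-! For (a), a hyperbolic cross: the sum of the spaces `V k₁ ⊗ ⋯ ⊗ V k_d` over levels with total at
most `K` has dimension of order `2^K K^(d-1)`. Projection increments at different levels are
orthogonal, so squared errors add and the error is of order `2^(-K/W) K^((d-1)/2)`
(`exists_hyperbolicCross`). Solving for `K` (`exists_level`) gives the log exponent `(d-1) +
(d-1)W/2`: the first term comes from the dimension, the second from the error.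

For (b), products of nets of columns are nets of the tensor power. For the hull, a cover of radius
`3ε/2` is refined to radius `ε` (`exists_finset_refine`). Inside an approximating space `𝒱` only a
ball of radius `3ε/2` must be covered, at cost `5^dim 𝒱`. Orthogonally to `𝒱` the columns have norm
at most `u`, and Maurey's argument needs about `(u/ε)²` terms, each costing `log(1/ε)`. The choice
`balancedAccuracy` of `u` makes both costs of order `entropyRate`. Since this rate shrinks
geometrically as the radius grows, the costs of all scales sum to the last one
(`entropy_recursion`), so the dimension term gains no extra logarithm. -/

/-! ### Covering numbers, finite nets and balls in finite dimension. -/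

theorem coveringNumber_le_of_finset {E : Type*} [PseudoMetricSpace E] {ε B : ℝ} (hε : 0 ≤ ε)
    {T : Set E} (N : Finset E) (hN : (N.card : ℝ) ≤ B) (h : ∀ x ∈ T, ∃ c ∈ N, dist x c ≤ ε) :
    coveringNumber ε T ≤ ENNReal.ofReal B := by
  have hc : Metric.IsCover ε.toNNReal T (N : Set E) := by
    rw [Metric.isCover_iff_subset_iUnion_closedBall]
    intro x hx
    obtain ⟨c, hc, hxc⟩ := h x hx
    simp only [Set.mem_iUnion, Metric.mem_closedBall, Real.coe_toNNReal _ hε]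
    exact ⟨c, hc, hxc⟩
  have h1 := hc.externalCoveringNumber_le_encard
  rw [Set.encard_coe_eq_coe_finsetCard] at h1
  calc coveringNumber ε T ≤ (((N.card : ℕ∞)) : ℝ≥0∞) := by
        unfold coveringNumber
        exact_mod_cast h1
    _ = ENNReal.ofReal (N.card : ℝ) := by simp
    _ ≤ _ := ENNReal.ofReal_le_ofReal hN

/-- Doubling the radius moves the centres into the family itself. Tensor products of centres are
then columns of the tensor power, and approximation bounds for columns apply to them. -/
theorem exists_net_of_coveringNumber_le {E κ : Type*} [PseudoMetricSpace E] {ε B : ℝ} (hε : 0 ≤ ε)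
    (hB : 0 ≤ B) (v : κ → E) (h : coveringNumber ε (Set.range v) ≤ ENNReal.ofReal B) :
    ∃ S : Finset κ, (S.card : ℝ) ≤ B ∧ ∀ j, ∃ i ∈ S, dist (v j) (v i) ≤ 2 * ε := by
  classical
  have hint : ((Metric.coveringNumber (2 * ε.toNNReal) (Set.range v) : ℕ∞) : ℝ≥0∞) ≤
      ENNReal.ofReal B := by
    refine le_trans ?_ h
    unfold coveringNumber
    exact_mod_cast Metric.coveringNumber_two_mul_le_externalCoveringNumber _ _
  have hfin : Metric.coveringNumber (2 * ε.toNNReal) (Set.range v) ≠ ⊤ := by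
    intro h0
    rw [h0] at hint
    simp at hint
  obtain ⟨C, hC, hCf, hcov, hcard⟩ := Metric.exists_set_encard_eq_coveringNumber hfin
  lift C to Finset E using hCf
  have hch : ∀ c : C, ∃ i, v i = c := fun c => hC c.2
  choose g hg using hch
  refine ⟨C.attach.image g, ?_, fun j => ?_⟩
  · rw [← hcard, Set.encard_coe_eq_coe_finsetCard] at hint
    have h2 : ENNReal.ofReal (C.card : ℝ) ≤ ENNReal.ofReal B := by simpa using hint
    have h3 := (ENNReal.ofReal_le_ofReal_iff hB).1 h2
    refine le_trans ?_ h3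
    exact_mod_cast Finset.card_image_le.trans (by simp)
  · rw [Metric.isCover_iff_subset_iUnion_closedBall] at hcov
    have := hcov (Set.mem_range_self j)
    simp only [Set.mem_iUnion, Metric.mem_closedBall] at this
    obtain ⟨c, hc, hd⟩ := this
    refine ⟨g ⟨c, hc⟩, by simp, ?_⟩
    rw [hg]
    simpa [Real.coe_toNNReal _ hε] using hd

/-- A 1-separated set in the ball of radius 2 has at most `5 ^ finrank` points; one of maximal size
is a 1-net, which is then scaled by `R / 2`. -/
theorem exists_finset_cover_closedBall_half {E : Type*} [NormedAddCommGroup E] [NormedSpace ℝ E]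
    [FiniteDimensional ℝ E] {R : ℝ} (hR : 0 < R) :
    ∃ N : Finset E, N.card ≤ 5 ^ Module.finrank ℝ E ∧
      ∀ x, ‖x‖ ≤ R → ∃ c ∈ N, ‖x - c‖ ≤ R / 2 := by
  classical
  let P : ℕ → Prop := fun n => ∃ s : Finset E, s.card = n ∧ (∀ c ∈ s, ‖c‖ ≤ 2) ∧
    ∀ c ∈ s, ∀ d ∈ s, c ≠ d → 1 ≤ ‖c - d‖
  have hP : ∀ n, P n → n ≤ 5 ^ Module.finrank ℝ E := by
    rintro n ⟨s, rfl, h1, h2⟩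
    exact Besicovitch.card_le_of_separated s h1 h2
  have hP0 : P 0 := ⟨∅, by simp⟩
  obtain ⟨s, hs, h1, h2⟩ := Nat.findGreatest_spec (P := P) (Nat.zero_le (5 ^ Module.finrank ℝ E)) hP0
  have key : ∀ y : E, ‖y‖ ≤ 2 → ∃ c ∈ s, ‖y - c‖ ≤ 1 := by
    intro y hy
    by_contra! hcon
    have hys : y ∉ s := fun h => by
      have := hcon y h
      simp at this
      linarith
    have hPs : P (s.card + 1) := by
      refine ⟨insert y s, by simp [hys], ?_, ?_⟩
      · intro c hc
        rcases Finset.mem_insert.1 hc with rfl | hc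
        · exact hy
        · exact h1 c hc
      · intro c hc d hd hcd
        rcases Finset.mem_insert.1 hc with hcy | hcs <;>
          rcases Finset.mem_insert.1 hd with hdy | hds
        · exact absurd (hcy.trans hdy.symm) hcd
        · rw [hcy]; exact (hcon d hds).le
        · rw [hdy, norm_sub_rev]; exact (hcon c hcs).le
        · exact h2 c hcs d hds hcd
    have := Nat.le_findGreatest (hP _ hPs) hPs
    omega
  refine ⟨s.image (fun c => (R / 2) • c), Finset.card_image_le.trans ?_, fun x hx => ?_⟩
  · exact hP _ ⟨s, rfl, h1, h2⟩
  · obtain ⟨c, hc, hxc⟩ := key ((R / 2)⁻¹ • x) (by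
      rw [norm_smul, Real.norm_of_nonneg (by positivity), inv_mul_le_iff₀ (by positivity)]
      linarith)
    refine ⟨(R / 2) • c, Finset.mem_image_of_mem _ hc, ?_⟩
    have : x - (R / 2) • c = (R / 2) • ((R / 2)⁻¹ • x - c) := by
      rw [smul_sub, smul_inv_smul₀ (by positivity)]
    rw [this, norm_smul, Real.norm_of_nonneg (by positivity)]
    nlinarith

/-! ### Maurey's empirical method and the refinement step. -/

section Maurey

variable {E κ : Type*} [NormedAddCommGroup E]

/-- The points `0` and `±y i`, `i ∈ S`. -/
def signedPoints (S : Finset κ) (y : κ → E) : Finset E := by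
  classical exact insert 0 (S.image y ∪ S.image (fun i => -y i))

theorem card_signedPoints_le (S : Finset κ) (y : κ → E) :
    (signedPoints S y).card ≤ 2 * S.card + 1 := by
  classical
  unfold signedPoints
  refine (Finset.card_insert_le _ _).trans ?_
  have h1 : (S.image y).card ≤ S.card := Finset.card_image_le
  have h2 : (S.image (fun i => -y i)).card ≤ S.card := Finset.card_image_le
  have := Finset.card_union_le (S.image y) (S.image (fun i => -y i))
  omega

theorem norm_le_of_mem_signedPoints {S : Finset κ} {y : κ → E} {u : ℝ} (hu : 0 ≤ u)
    (hy : ∀ i ∈ S, ‖y i‖ ≤ u) {z : E} (hz : z ∈ signedPoints S y) : ‖z‖ ≤ u := by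
  classical
  simp only [signedPoints, Finset.mem_insert, Finset.mem_union, Finset.mem_image] at hz
  rcases hz with rfl | ⟨i, hi, rfl⟩ | ⟨i, hi, rfl⟩
  · simpa
  · exact hy i hi
  · simpa using hy i hi

variable [InnerProductSpace ℝ E]

theorem norm_sum_smul_le {J : Type*} [Fintype J] {y : J → E} {u : ℝ} (hu : 0 ≤ u)
    (hy : ∀ j, ‖y j‖ ≤ u) {β : J → ℝ} (hβ : ∑ j, |β j| ≤ 1) : ‖∑ j, β j • y j‖ ≤ u := by
  calc ‖∑ j, β j • y j‖ ≤ ∑ j, ‖β j • y j‖ := norm_sum_le _ _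
    _ ≤ ∑ j, |β j| * u := by
        refine Finset.sum_le_sum fun j _ => ?_
        rw [norm_smul, Real.norm_eq_abs]
        exact mul_le_mul_of_nonneg_left (hy j) (abs_nonneg _)
    _ = (∑ j, |β j|) * u := by rw [Finset.sum_mul]
    _ ≤ u := by nlinarith

/-- In every direction `w`, some signed point lies below a given element of the absolute convex
hull. -/
theorem exists_signedPoint_inner_le {J : Type*} [Fintype J] (S : Finset κ) (y : κ → E)
    (p : J → κ) (hp : ∀ j, p j ∈ S) {β : J → ℝ} (hβ : ∑ j, |β j| ≤ 1) (w : E) :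
    ∃ z ∈ signedPoints S y, inner ℝ w z ≤ inner ℝ w (∑ j, β j • y (p j)) := by
  classical
  set x := ∑ j, β j • y (p j) with hx
  -- Otherwise `0` and all `±y i` lie strictly above `x` in direction `w`, so every `|⟨w, y (p j)⟩|`
  -- is below `-⟨w, x⟩`; averaging with total weight at most 1 contradicts the value at `x`.
  by_contra! hcon
  have h0 : inner ℝ w x < 0 := by
    have := hcon 0 (by simp [signedPoints])
    simpa using this
  have hj : ∀ j, |inner ℝ w (y (p j))| < -inner ℝ w x := by
    intro j
    have h1 := hcon (y (p j)) (by
      simp only [signedPoints, Finset.mem_insert, Finset.mem_union, Finset.mem_image]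
      exact Or.inr (Or.inl ⟨p j, hp j, rfl⟩))
    have h2 := hcon (-y (p j)) (by
      simp only [signedPoints, Finset.mem_insert, Finset.mem_union, Finset.mem_image]
      exact Or.inr (Or.inr ⟨p j, hp j, rfl⟩))
    rw [inner_neg_right] at h2
    rw [abs_lt]
    constructor <;> linarith
  have hs : inner ℝ w x = ∑ j, β j * inner ℝ w (y (p j)) := by
    rw [hx, inner_sum]
    simp [inner_smul_right]
  by_cases hall : ∃ j, β j ≠ 0
  · obtain ⟨j0, hj0⟩ := hall
    have : ∑ j, |β j| * |inner ℝ w (y (p j))| < ∑ j, |β j| * (-inner ℝ w x) := by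
      refine Finset.sum_lt_sum (fun j _ => mul_le_mul_of_nonneg_left (hj j).le (abs_nonneg _))
        ⟨j0, Finset.mem_univ _, mul_lt_mul_of_pos_left (hj j0) (abs_pos.2 hj0)⟩
    have h2 : -inner ℝ w x ≤ ∑ j, |β j| * |inner ℝ w (y (p j))| := by
      rw [hs, ← Finset.sum_neg_distrib]
      refine Finset.sum_le_sum fun j _ => ?_
      rw [← abs_mul]
      exact neg_le_abs _
    rw [← Finset.sum_mul] at this
    nlinarith
  · push Not at hall
    rw [hs] at h0
    simp [hall] at h0

/-- A greedy version of the random sampling: each new point is chosen with nonpositive inner product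
between its deviation and the accumulated deviation, so the squared norm grows by at most `(2 * u) ^
2`. -/
theorem exists_maurey_points {J : Type*} [Fintype J] (S : Finset κ) (y : κ → E) {u : ℝ}
    (hu : 0 ≤ u) (hy : ∀ i ∈ S, ‖y i‖ ≤ u)
    (p : J → κ) (hp : ∀ j, p j ∈ S) {β : J → ℝ} (hβ : ∑ j, |β j| ≤ 1) (k : ℕ) :
    ∃ z : Fin k → E, (∀ i, z i ∈ signedPoints S y) ∧
      ‖∑ i, (z i - ∑ j, β j • y (p j))‖ ^ 2 ≤ k * (2 * u) ^ 2 := by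
  induction k with
  | zero => exact ⟨Fin.elim0, fun i => i.elim0, by simp⟩
  | succ k ih =>
    obtain ⟨z, hz, hzn⟩ := ih
    set x := ∑ j, β j • y (p j) with hx
    have hxn : ‖x‖ ≤ u := norm_sum_smul_le hu (fun j => hy _ (hp j)) hβ
    obtain ⟨a, ha, hle⟩ := exists_signedPoint_inner_le S y p hp hβ (∑ i, (z i - x))
    refine ⟨Fin.snoc z a, fun i => ?_, ?_⟩
    · induction i using Fin.lastCases with
      | last => simpa using ha
      | cast i => simpa using hz i
    · rw [Fin.sum_univ_castSucc]
      simp only [Fin.snoc_castSucc, Fin.snoc_last]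
      rw [norm_add_sq_real, inner_sub_right]
      have h1 : ‖a - x‖ ≤ 2 * u := by
        have := norm_sub_le a x
        have := norm_le_of_mem_signedPoints hu hy ha
        linarith
      have h2 : ‖a - x‖ ^ 2 ≤ (2 * u) ^ 2 := pow_le_pow_left₀ (norm_nonneg _) h1 2
      push_cast
      linarith

/-- Maurey's covering of an absolute convex hull. -/
theorem exists_maurey_finset (S : Finset κ) (y : κ → E) {u ρ : ℝ} (hu : 0 ≤ u) (hρ : 0 ≤ ρ)
    (hy : ∀ i ∈ S, ‖y i‖ ≤ u) {k : ℕ} (hk : 0 < k) (hkρ : (2 * u) ^ 2 ≤ k * ρ ^ 2) :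
    ∃ N : Finset E, N.card ≤ (2 * S.card + 1) ^ k ∧
      ∀ (J : Type) [Fintype J] (p : J → κ), (∀ j, p j ∈ S) → ∀ β : J → ℝ, ∑ j, |β j| ≤ 1 →
        ∃ c ∈ N, ‖∑ j, β j • y (p j) - c‖ ≤ ρ := by
  classical
  -- The centres are all averages of `k` signed points, independently of `β`.
  refine ⟨(Fintype.piFinset (fun _ : Fin k => signedPoints S y)).image
    (fun z => (k : ℝ)⁻¹ • ∑ i, z i), ?_, ?_⟩
  · refine Finset.card_image_le.trans ?_
    rw [Fintype.card_piFinset]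
    simp only [Finset.prod_const, Finset.card_univ, Fintype.card_fin]
    exact Nat.pow_le_pow_left (card_signedPoints_le S y) k
  · intro J _ p hp β hβ
    obtain ⟨z, hz, hzn⟩ := exists_maurey_points S y hu hy p hp hβ k
    refine ⟨_, Finset.mem_image_of_mem _ (Fintype.mem_piFinset.2 hz), ?_⟩
    set x := ∑ j, β j • y (p j)
    have hk0 : (0 : ℝ) < k := by exact_mod_cast hk
    have he : x - (k : ℝ)⁻¹ • ∑ i, z i = -((k : ℝ)⁻¹ • ∑ i, (z i - x)) := by
      rw [Finset.sum_sub_distrib, smul_sub]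
      simp only [Finset.sum_const, Finset.card_univ, Fintype.card_fin]
      rw [← Nat.cast_smul_eq_nsmul ℝ, inv_smul_smul₀ hk0.ne']
      abel
    rw [he, norm_neg, norm_smul, Real.norm_of_nonneg (by positivity), inv_mul_le_iff₀ hk0]
    refine le_of_sq_le_sq ?_ (by positivity)
    nlinarith

/-- One refinement step for coverings of the absolute convex hull of `v`. -/
theorem exists_finset_refine {J : Type} [Fintype J] [FiniteDimensional ℝ E] (v : J → E)
    (𝒱 : Submodule ℝ E) {ε u : ℝ} (hε : 0 < ε) (hu : 0 ≤ u)
    (hv : ∀ j, ‖𝒱ᗮ.starProjection (v j)‖ ≤ u)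
    (S : Finset J) (hS : ∀ j, ∃ i ∈ S, dist (v j) (v i) ≤ ε / 8)
    {k : ℕ} (hk : 0 < k) (hku : (16 * u) ^ 2 ≤ k * ε ^ 2)
    (N₀ : Finset E) (hN₀ : ∀ β : J → ℝ, ∑ j, |β j| ≤ 1 →
      ∃ c ∈ N₀, dist (∑ j, β j • v j) c ≤ 3 / 2 * ε) :
    ∃ N : Finset E, N.card ≤ N₀.card * 5 ^ Module.finrank ℝ 𝒱 * (2 * S.card + 1) ^ k ∧
      ∀ β : J → ℝ, ∑ j, |β j| ≤ 1 → ∃ c ∈ N, dist (∑ j, β j • v j) c ≤ ε := by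
  classical
  choose p hpS hp using hS
  obtain ⟨N₁, hN₁c, hN₁⟩ := exists_finset_cover_closedBall_half (E := 𝒱)
    (R := 3 / 2 * ε) (by positivity)
  obtain ⟨N₂, hN₂c, hN₂⟩ := exists_maurey_finset S (fun i => 𝒱ᗮ.starProjection (v i)) hu
    (ρ := ε / 8) (by positivity) (fun i _ => hv i) hk (by nlinarith)
  -- The error budget is `3ε/4` inside `𝒱` (half of the old radius), `ε/8` for replacing columns by
  -- net columns, and `ε/8` for Maurey's averages. Only the component in `𝒱` uses the coarser cover.
  refine ⟨((N₀ ×ˢ N₁) ×ˢ N₂).image (fun a => 𝒱.starProjection a.1.1 + a.1.2 + a.2), ?_, ?_⟩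
  · refine Finset.card_image_le.trans ?_
    rw [Finset.card_product, Finset.card_product]
    gcongr
  · intro β hβ
    set f := ∑ j, β j • v j with hf
    obtain ⟨c, hc, hfc⟩ := hN₀ β hβ
    obtain ⟨a, ha, hfa⟩ := hN₁ (𝒱.orthogonalProjectionOnto (f - c)) (by
      rw [dist_eq_norm] at hfc
      exact (𝒱.norm_orthogonalProjectionOnto_apply_le _).trans hfc)
    obtain ⟨b, hb, hfb⟩ := hN₂ J p hpS β hβ
    refine ⟨_, Finset.mem_image_of_mem _
      (Finset.mk_mem_product (Finset.mk_mem_product hc ha) hb), ?_⟩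
    have hdec : f = 𝒱.starProjection f + 𝒱ᗮ.starProjection f :=
      (𝒱.starProjection_add_starProjection_orthogonal f).symm
    have h1 : ‖𝒱.starProjection (f - c) - a‖ ≤ 3 / 2 * ε / 2 := by
      simpa using hfa
    have h2 : ‖𝒱ᗮ.starProjection f - ∑ j, β j • 𝒱ᗮ.starProjection (v (p j))‖ ≤ ε / 8 := by
      have he : 𝒱ᗮ.starProjection f - ∑ j, β j • 𝒱ᗮ.starProjection (v (p j)) =
          ∑ j, β j • 𝒱ᗮ.starProjection (v j - v (p j)) := by
        rw [hf, map_sum, ← Finset.sum_sub_distrib]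
        simp only [map_sub, map_smul, smul_sub]
      rw [he]
      refine norm_sum_smul_le (by positivity) (fun j => ?_) hβ
      refine (𝒱ᗮ.norm_starProjection_apply_le _).trans ?_
      rw [← dist_eq_norm]
      exact hp j
    have he : f - (𝒱.starProjection c + a + b) = (𝒱.starProjection (f - c) - a) +
        (𝒱ᗮ.starProjection f - ∑ j, β j • 𝒱ᗮ.starProjection (v (p j))) +
        (∑ j, β j • 𝒱ᗮ.starProjection (v (p j)) - b) := by
      conv_lhs => rw [hdec]
      rw [map_sub]
      abel
    rw [dist_eq_norm, he]
    have := norm_add₃_le (a := 𝒱.starProjection (f - c) - (a : E))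
      (b := 𝒱ᗮ.starProjection f - ∑ j, β j • 𝒱ᗮ.starProjection (v (p j)))
      (c := ∑ j, β j • 𝒱ᗮ.starProjection (v (p j)) - b)
    linarith

end Maurey

/-! ### Tensor products: dimensions, inner products and columns. -/

theorem finrank_map₂_le {K M N P : Type*} [Field K] [AddCommGroup M] [Module K M] [AddCommGroup N]
    [Module K N] [AddCommGroup P] [Module K P] [FiniteDimensional K M] [FiniteDimensional K N]
    (f : M →ₗ[K] N →ₗ[K] P) (p : Submodule K M) (q : Submodule K N) :
    Module.finrank K (Submodule.map₂ f p q) ≤ Module.finrank K p * Module.finrank K q := by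
  rw [TensorProduct.map₂_eq_range_lift_comp_mapIncl]
  refine (LinearMap.finrank_range_le _).trans ?_
  rw [Module.finrank_tensorProduct]

theorem finrank_finset_sup_le {ι K M : Type*} [Field K] [AddCommGroup M] [Module K M]
    [FiniteDimensional K M] (s : Finset ι) (f : ι → Submodule K M) :
    Module.finrank K (s.sup f : Submodule K M) ≤ ∑ i ∈ s, Module.finrank K (f i) := by
  classical
  induction s using Finset.induction_on with
  | empty => simp
  | insert a s ha ih =>
    rw [Finset.sup_insert, Finset.sum_insert ha]
    exact (Submodule.finrank_add_le_finrank_add_finrank _ _).trans (by gcongr)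

/-- The tensor product `v ⊗ y`, with the coordinate of `v` put first. -/
def tensorCons {m d : ℕ} : EuclideanSpace ℝ (Fin m) →ₗ[ℝ] EuclideanSpace ℝ (Fin d → Fin m) →ₗ[ℝ]
    EuclideanSpace ℝ (Fin (d + 1) → Fin m) :=
  LinearMap.mk₂ ℝ (fun v y => WithLp.toLp 2 fun i => v (i 0) * y (Fin.tail i))
    (fun _ _ _ => by ext; simp [add_mul])
    (fun _ _ _ => by ext; simp [mul_assoc])
    (fun _ _ _ => by ext; simp [mul_add])
    (fun _ _ _ => by ext; simp [mul_left_comm])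

theorem tensorCons_apply {m d : ℕ} (v : EuclideanSpace ℝ (Fin m))
    (y : EuclideanSpace ℝ (Fin d → Fin m)) (i : Fin (d + 1) → Fin m) :
    tensorCons v y i = v (i 0) * y (Fin.tail i) := rfl

theorem inner_tensorCons {m d : ℕ} (v v' : EuclideanSpace ℝ (Fin m))
    (y y' : EuclideanSpace ℝ (Fin d → Fin m)) :
    inner ℝ (tensorCons v y) (tensorCons v' y') = inner ℝ v v' * inner ℝ y y' := by
  simp only [PiLp.inner_apply, tensorCons_apply]
  rw [← (Fin.consEquiv (fun _ : Fin (d + 1) => Fin m)).sum_comp, Fintype.sum_prod_type,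
    Finset.sum_mul_sum]
  refine Finset.sum_congr rfl fun a _ => Finset.sum_congr rfl fun b _ => ?_
  simp [Fin.consEquiv]
  ring

theorem norm_tensorCons {m d : ℕ} (v : EuclideanSpace ℝ (Fin m))
    (y : EuclideanSpace ℝ (Fin d → Fin m)) : ‖tensorCons v y‖ = ‖v‖ * ‖y‖ := by
  rw [← sq_eq_sq₀ (norm_nonneg _) (by positivity), mul_pow]
  simp only [← real_inner_self_eq_norm_sq, inner_tensorCons]

theorem column_tensorPower_succ {m r d : ℕ} (Ψ : Matrix (Fin m) (Fin r) ℝ)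
    (j : Fin (d + 1) → Fin r) :
    column (tensorPower (d + 1) Ψ) j =
      tensorCons (column Ψ (j 0)) (column (tensorPower d Ψ) (Fin.tail j)) := by
  ext i
  simp [tensorCons_apply, column, tensorPower, Fin.prod_univ_succ, Fin.tail]

theorem norm_column_tensorPower_le {m r : ℕ} {Ψ : Matrix (Fin m) (Fin r) ℝ}
    (h : ∀ j, ‖column Ψ j‖ ≤ 1) (d : ℕ) (j : Fin d → Fin r) :
    ‖column (tensorPower d Ψ) j‖ ≤ 1 := by
  induction d with
  | zero => simp [EuclideanSpace.norm_eq, column, tensorPower]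
  | succ d ih =>
    rw [column_tensorPower_succ, norm_tensorCons]
    exact mul_le_one₀ (h _) (norm_nonneg _) (ih _)

theorem dist_column_tensorPower_le {m r : ℕ} {Ψ : Matrix (Fin m) (Fin r) ℝ}
    (h : ∀ j, ‖column Ψ j‖ ≤ 1) {ρ : ℝ} (d : ℕ) (j i : Fin d → Fin r)
    (hji : ∀ k, dist (column Ψ (j k)) (column Ψ (i k)) ≤ ρ) :
    dist (column (tensorPower d Ψ) j) (column (tensorPower d Ψ) i) ≤ d * ρ := by
  induction d with
  | zero =>
    have : j = i := Subsingleton.elim _ _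
    simp [this]
  | succ d ih =>
    have h1 := ih (Fin.tail j) (Fin.tail i) (fun k => hji k.succ)
    have h0 := hji 0
    rw [column_tensorPower_succ, column_tensorPower_succ, dist_eq_norm]
    rw [dist_eq_norm] at h0 h1
    set a := column Ψ (j 0)
    set b := column Ψ (i 0)
    set y := column (tensorPower d Ψ) (Fin.tail j)
    set z := column (tensorPower d Ψ) (Fin.tail i)
    -- Changing one factor at a time costs `ρ` per factor, since all factors have norm at most 1.
    have he : tensorCons a y - tensorCons b z = tensorCons (a - b) y + tensorCons b (y - z) := by
      simp only [map_sub, LinearMap.sub_apply]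
      abel
    have hy : ‖y‖ ≤ 1 := norm_column_tensorPower_le h d _
    have hb : ‖b‖ ≤ 1 := h _
    rw [he]
    refine (norm_add_le _ _).trans ?_
    rw [norm_tensorCons, norm_tensorCons]
    push_cast
    nlinarith [mul_le_of_le_one_right (norm_nonneg (a - b)) hy,
      mul_le_of_le_one_left (norm_nonneg (y - z)) hb]

theorem norm_sum_range_sq_of_orthogonal {E : Type*} [NormedAddCommGroup E] [InnerProductSpace ℝ E]
    (f : ℕ → E) (h : ∀ k n, k < n → inner ℝ (f k) (f n) = 0) (n : ℕ) :
    ‖∑ k ∈ Finset.range n, f k‖ ^ 2 = ∑ k ∈ Finset.range n, ‖f k‖ ^ 2 := by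
  induction n with
  | zero => simp
  | succ n ih =>
    rw [Finset.sum_range_succ, Finset.sum_range_succ, norm_add_sq_real, ih, sum_inner,
      Finset.sum_eq_zero (fun k hk => h k n (Finset.mem_range.1 hk))]
    ring

/-! ### Hyperbolic cross approximation. -/

section HyperbolicCross

variable {m d : ℕ} (V : ℕ → Submodule ℝ (EuclideanSpace ℝ (Fin m)))

/-- The increment of the projection of `x` from `V k` to `V (k + 1)`. -/
def projIncrement (x : EuclideanSpace ℝ (Fin m)) (k : ℕ) : EuclideanSpace ℝ (Fin m) :=
  (V (k + 1)).starProjection x - (V k).starProjection x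

variable {V}

theorem projIncrement_mem (hV : Monotone V) (x : EuclideanSpace ℝ (Fin m)) (k : ℕ) :
    projIncrement V x k ∈ V (k + 1) :=
  Submodule.sub_mem _ (Submodule.starProjection_apply_mem _ _)
    (hV (Nat.le_succ k) (Submodule.starProjection_apply_mem _ _))

theorem inner_sub_starProjection_eq_zero (hV : Monotone V) {a x : EuclideanSpace ℝ (Fin m)}
    {k n : ℕ} (hkn : k ≤ n) (ha : a ∈ V k) : inner ℝ a (x - (V n).starProjection x) = 0 :=
  (Submodule.mem_orthogonal _ _).1 (Submodule.sub_starProjection_mem_orthogonal _) a (hV hkn ha)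

theorem inner_projIncrement (hV : Monotone V) (x : EuclideanSpace ℝ (Fin m)) {k n : ℕ}
    (hkn : k < n) : inner ℝ (projIncrement V x k) (projIncrement V x n) = 0 := by
  have he : projIncrement V x n =
      (x - (V n).starProjection x) - (x - (V (n + 1)).starProjection x) := by
    unfold projIncrement; abel
  rw [he, inner_sub_right, inner_sub_starProjection_eq_zero hV hkn (projIncrement_mem hV x k),
    inner_sub_starProjection_eq_zero hV (by omega : k + 1 ≤ n + 1) (projIncrement_mem hV x k),
    sub_zero]

/-- Pythagoras: `x` telescopes into increments and a remainder, all mutually orthogonal, and the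
first tensor factor transfers this orthogonality. Hence `y` may be approximated by a different `a k`
at each level. -/
theorem norm_hyperbolicCross_error (hV : Monotone V) (hV0 : V 0 = ⊥)
    (x : EuclideanSpace ℝ (Fin m)) (y : EuclideanSpace ℝ (Fin d → Fin m))
    (a : ℕ → EuclideanSpace ℝ (Fin d → Fin m)) (n : ℕ) :
    ‖tensorCons x y - ∑ k ∈ Finset.range n, tensorCons (projIncrement V x k) (a k)‖ ^ 2 =
      ∑ k ∈ Finset.range n, ‖projIncrement V x k‖ ^ 2 * ‖y - a k‖ ^ 2 +
        ‖x - (V n).starProjection x‖ ^ 2 * ‖y‖ ^ 2 := by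
  have hx : x = ∑ k ∈ Finset.range n, projIncrement V x k + (x - (V n).starProjection x) := by
    unfold projIncrement
    rw [Finset.sum_range_sub (fun k => (V k).starProjection x), hV0]
    simp
  have he : tensorCons x y - ∑ k ∈ Finset.range n, tensorCons (projIncrement V x k) (a k) =
      ∑ k ∈ Finset.range n, tensorCons (projIncrement V x k) (y - a k) +
        tensorCons (x - (V n).starProjection x) y := by
    conv_lhs => enter [1]; rw [hx]
    simp only [map_add, map_sum, LinearMap.add_apply, LinearMap.sum_apply, map_sub,
      Finset.sum_sub_distrib]
    abel
  have hcross : ∑ k ∈ Finset.range n, inner ℝ (tensorCons (projIncrement V x k) (y - a k))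
      (tensorCons (x - (V n).starProjection x) y) = 0 :=
    Finset.sum_eq_zero fun k hk => by
      rw [inner_tensorCons, inner_sub_starProjection_eq_zero hV
        (Finset.mem_range.1 hk : k + 1 ≤ n) (projIncrement_mem hV x k), zero_mul]
  rw [he, norm_add_sq_real, norm_sum_range_sq_of_orthogonal _ (fun k n hkn => by
    rw [inner_tensorCons, inner_projIncrement hV x hkn, zero_mul]), sum_inner, hcross]
  simp only [norm_tensorCons, mul_pow]
  ring

theorem norm_projIncrement_le {x : EuclideanSpace ℝ (Fin m)} {G s : ℝ} (hG : 0 ≤ G)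
    (hs0 : 0 ≤ s) (hs1 : s ≤ 1)
    (hx : ∀ n, ‖x - (V n).starProjection x‖ ≤ G * s ^ n) (k : ℕ) :
    ‖projIncrement V x k‖ ≤ 2 * G * s ^ k := by
  have he : projIncrement V x k =
      (x - (V k).starProjection x) - (x - (V (k + 1)).starProjection x) := by
    unfold projIncrement; abel
  have h1 : G * s ^ (k + 1) ≤ G * s ^ k :=
    mul_le_mul_of_nonneg_left (pow_le_pow_of_le_one hs0 hs1 (Nat.le_succ k)) hG
  rw [he]
  have := norm_sub_le (x - (V k).starProjection x) (x - (V (k + 1)).starProjection x)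
  linarith [hx k, hx (k + 1)]

/-- The hyperbolic cross approximation of the tensor power. -/
theorem exists_hyperbolicCross (hV : Monotone V) (hV0 : V 0 = ⊥) {q r : ℕ}
    (hq : ∀ k, Module.finrank ℝ (V (k + 1)) ≤ q * 2 ^ k) (Ψ : Matrix (Fin m) (Fin r) ℝ)
    (hΨ : ∀ j, ‖column Ψ j‖ ≤ 1) {G s : ℝ} (hG : 1 ≤ G) (hs0 : 0 ≤ s) (hs1 : s ≤ 1)
    (happ : ∀ j n, ‖column Ψ j - (V n).starProjection (column Ψ j)‖ ≤ G * s ^ n) (d : ℕ) :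
    ∃ U : ℕ → Submodule ℝ (EuclideanSpace ℝ (Fin (d + 1) → Fin m)), ∀ K,
      Module.finrank ℝ (U K) ≤ q ^ (d + 1) * 2 ^ K * (K + 1) ^ d ∧
      ∀ j, ∃ g ∈ U K, ‖column (tensorPower (d + 1) Ψ) j - g‖ ^ 2 ≤
        (8 * G ^ 2) ^ (d + 1) * (K + 1) ^ d * (s ^ K) ^ 2 := by
  have hsK : ∀ K : ℕ, s ^ (K + 1) ≤ s ^ K := fun K =>
    pow_le_pow_of_le_one hs0 hs1 (Nat.le_succ K)
  have hlast : ∀ (j : Fin r) (K : ℕ),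
      ‖column Ψ j - (V (K + 1)).starProjection (column Ψ j)‖ ^ 2 ≤ G ^ 2 * (s ^ K) ^ 2 := by
    intro j K
    rw [← mul_pow]
    refine pow_le_pow_left₀ (norm_nonneg _) ((happ j (K + 1)).trans ?_) 2
    exact mul_le_mul_of_nonneg_left (hsK K) (by linarith)
  induction d with
  | zero =>
    -- The empty tensor power lives in a one-dimensional space, so `⊤` costs no dimension.
    refine ⟨fun K => Submodule.map₂ tensorCons (V (K + 1)) ⊤, fun K => ⟨?_, fun j => ?_⟩⟩
    · refine (finrank_map₂_le _ _ _).trans ?_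
      simpa using hq K
    · refine ⟨tensorCons ((V (K + 1)).starProjection (column Ψ (j 0)))
        (column (tensorPower 0 Ψ) (Fin.tail j)),
        Submodule.apply_mem_map₂ _ (Submodule.starProjection_apply_mem _ _) trivial, ?_⟩
      rw [column_tensorPower_succ, ← LinearMap.sub_apply, ← map_sub, norm_tensorCons, mul_pow]
      have h1 : ‖column (tensorPower 0 Ψ) (Fin.tail j)‖ ^ 2 ≤ 1 :=
        pow_le_one₀ (norm_nonneg _) (norm_column_tensorPower_le hΨ 0 _)
      have h2 := hlast (j 0) K
      have h3 := mul_le_of_le_one_right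
        (sq_nonneg ‖column Ψ (j 0) - (V (K + 1)).starProjection (column Ψ (j 0))‖) h1
      have h4 : 0 ≤ G ^ 2 * (s ^ K) ^ 2 := by positivity
      simp only [zero_add, pow_one, pow_zero, mul_one]
      linarith
  | succ d ih =>
    obtain ⟨U, hU⟩ := ih
    -- Level `k` in the first factor is paired with level `K - k` in the others, so each summand has
    -- the same dimension bound and the same error bound, up to powers of `K + 1`.
    refine ⟨fun K => (Finset.range (K + 1)).sup
      (fun k => Submodule.map₂ tensorCons (V (k + 1)) (U (K - k))), fun K => ⟨?_, fun j => ?_⟩⟩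
    · calc _ ≤ ∑ k ∈ Finset.range (K + 1),
            Module.finrank ℝ (Submodule.map₂ tensorCons (V (k + 1)) (U (K - k))) :=
            finrank_finset_sup_le _ _
        _ ≤ ∑ k ∈ Finset.range (K + 1), q ^ (d + 1 + 1) * 2 ^ K * (K + 1) ^ d := by
            refine Finset.sum_le_sum fun k hk => (finrank_map₂_le _ _ _).trans ?_
            have hk' : k ≤ K := by simpa [Nat.lt_succ_iff] using hk
            calc _ ≤ (q * 2 ^ k) * (q ^ (d + 1) * 2 ^ (K - k) * ((K - k) + 1) ^ d) :=
                  Nat.mul_le_mul (hq k) (hU (K - k)).1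
              _ ≤ (q * 2 ^ k) * (q ^ (d + 1) * 2 ^ (K - k) * (K + 1) ^ d) := by
                  gcongr; omega
              _ = q ^ (d + 1 + 1) * (2 ^ k * 2 ^ (K - k)) * (K + 1) ^ d := by ring
              _ = _ := by rw [← pow_add, Nat.add_sub_cancel' hk']
        _ = _ := by
            rw [Finset.sum_const, Finset.card_range, smul_eq_mul]
            ring
    · choose g hgU hg using fun k => (hU (K - k)).2 (Fin.tail j)
      refine ⟨∑ k ∈ Finset.range (K + 1),
        tensorCons (projIncrement V (column Ψ (j 0)) k) (g k), ?_, ?_⟩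
      · refine Submodule.sum_mem _ fun k hk => ?_
        exact Finset.le_sup (f := fun k => Submodule.map₂ tensorCons (V (k + 1)) (U (K - k))) hk
          (Submodule.apply_mem_map₂ _ (projIncrement_mem hV _ k) (hgU k))
      · rw [column_tensorPower_succ, norm_hyperbolicCross_error hV hV0]
        set y := column (tensorPower (d + 1) Ψ) (Fin.tail j)
        set x := column Ψ (j 0)
        have hterm : ∀ k ∈ Finset.range (K + 1), ‖projIncrement V x k‖ ^ 2 * ‖y - g k‖ ^ 2 ≤
            4 * G ^ 2 * ((8 * G ^ 2) ^ (d + 1) * (K + 1) ^ d * (s ^ K) ^ 2) := by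
          intro k hk
          have hk' : k ≤ K := by simpa [Nat.lt_succ_iff] using hk
          have h1 : ‖projIncrement V x k‖ ^ 2 ≤ (2 * G * s ^ k) ^ 2 :=
            pow_le_pow_left₀ (norm_nonneg _)
              (norm_projIncrement_le (by linarith) hs0 hs1 (happ (j 0)) k) 2
          calc _ ≤ (2 * G * s ^ k) ^ 2 * ((8 * G ^ 2) ^ (d + 1) * (((K - k : ℕ) : ℝ) + 1) ^ d *
                (s ^ (K - k)) ^ 2) := mul_le_mul h1 (hg k) (sq_nonneg _) (sq_nonneg _)
            _ ≤ (2 * G * s ^ k) ^ 2 * ((8 * G ^ 2) ^ (d + 1) * ((K : ℝ) + 1) ^ d *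
                (s ^ (K - k)) ^ 2) := by
                gcongr
                omega
            _ = 4 * G ^ 2 * ((8 * G ^ 2) ^ (d + 1) * ((K : ℝ) + 1) ^ d *
                (s ^ k * s ^ (K - k)) ^ 2) := by ring
            _ = _ := by rw [← pow_add, Nat.add_sub_cancel' hk']
        have hsum := Finset.sum_le_sum hterm
        rw [Finset.sum_const, Finset.card_range, nsmul_eq_mul] at hsum
        have hy : ‖y‖ ^ 2 ≤ 1 :=
          pow_le_one₀ (norm_nonneg _) (norm_column_tensorPower_le hΨ _ _)
        have h2 := hlast (j 0) K
        have h3 := mul_le_of_le_one_right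
          (sq_nonneg ‖x - (V (K + 1)).starProjection x‖) hy
        have hc1 : (1 : ℝ) ≤ (8 * G ^ 2) ^ (d + 1) := one_le_pow₀ (by nlinarith)
        have hK1 : (1 : ℝ) ≤ ((K : ℝ) + 1) ^ (d + 1) :=
          one_le_pow₀ (by linarith [(Nat.cast_nonneg K : (0 : ℝ) ≤ K)])
        have h4 : G ^ 2 * (s ^ K) ^ 2 ≤
            ((8 * G ^ 2) ^ (d + 1) * ((K : ℝ) + 1) ^ (d + 1)) * (G ^ 2 * (s ^ K) ^ 2) :=
          le_mul_of_one_le_left (by positivity) (one_le_mul_of_one_le_of_one_le hc1 hK1)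
        have h5 : 0 ≤ ((8 * G ^ 2) ^ (d + 1) * ((K : ℝ) + 1) ^ (d + 1)) *
          (G ^ 2 * (s ^ K) ^ 2) := by positivity
        push_cast at hsum
        have e1 : ((K : ℝ) + 1) * (4 * G ^ 2 * ((8 * G ^ 2) ^ (d + 1) * (K + 1) ^ d *
            (s ^ K) ^ 2)) = 4 * (((8 * G ^ 2) ^ (d + 1) * ((K : ℝ) + 1) ^ (d + 1)) *
            (G ^ 2 * (s ^ K) ^ 2)) := by ring
        have e2 : (8 * G ^ 2) ^ (d + 1 + 1) * ((K : ℝ) + 1) ^ (d + 1) * (s ^ K) ^ 2 =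
            8 * (((8 * G ^ 2) ^ (d + 1) * ((K : ℝ) + 1) ^ (d + 1)) *
            (G ^ 2 * (s ^ K) ^ 2)) := by ring
        -- The `K + 1` levels contribute 4 copies of the common bound and the remainder 1, within
        -- the 8 allowed per factor.
        rw [e2]
        have h6 : ‖x - (V (K + 1)).starProjection x‖ ^ 2 * ‖y‖ ^ 2 ≤
            ((8 * G ^ 2) ^ (d + 1) * ((K : ℝ) + 1) ^ (d + 1)) * (G ^ 2 * (s ^ K) ^ 2) :=
          h3.trans (h2.trans h4)
        rw [e1] at hsum
        linarith

end HyperbolicCross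

/-! ### Choice of the level, and approximating subspaces of given accuracy. -/

/-- Resolves a circularity in `exists_level`: the safety margin `x` in the level must beat a
constant that itself grows polynomially in `x`. -/
theorem exists_mul_pow_le_exp (c b : ℝ) (hb : 0 ≤ b) (a : ℝ) (ha : 0 ≤ a) (D : ℕ) :
    ∃ x : ℝ, 1 ≤ x ∧ c * (a * x + b) ^ D ≤ Real.exp (2 * x) := by
  have h := (Real.tendsto_pow_mul_exp_neg_atTop_nhds_zero D).const_mul (|c| * (a + b) ^ D)
  rw [mul_zero] at h
  have h1 := h.eventually (ge_mem_nhds (show (0 : ℝ) < 1 by norm_num))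
  obtain ⟨x, hx, hx1⟩ := (h1.and (Filter.eventually_ge_atTop 1)).exists
  refine ⟨x, hx1, ?_⟩
  have h2 : a * x + b ≤ (a + b) * x := by nlinarith
  calc c * (a * x + b) ^ D ≤ |c| * ((a + b) * x) ^ D := by
        gcongr
        exact le_abs_self c
    _ = |c| * (a + b) ^ D * (x ^ D * Real.exp (-x)) * Real.exp x := by
        rw [mul_pow, Real.exp_neg]
        field_simp
    _ ≤ 1 * Real.exp x := by gcongr
    _ ≤ Real.exp (2 * x) := by
        rw [one_mul]
        exact Real.exp_le_exp.2 (by linarith)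

/-- The choice of the level of the hyperbolic cross for a given accuracy `u`. -/
theorem exists_level {W : ℝ} (hW : 0 < W) (D : ℕ) {c : ℝ} (hc : 0 ≤ c) :
    ∃ C : ℝ, 0 < C ∧ ∀ u : ℝ, 0 < u → u ≤ 1 → ∃ K : ℕ,
      c * ((K : ℝ) + 1) ^ D * (((2 : ℝ) ^ (-1 / W)) ^ K) ^ 2 ≤ u ^ 2 ∧
      (2 : ℝ) ^ K * ((K : ℝ) + 1) ^ D ≤
        C * (u ^ (-W) * (1 - Real.log u) ^ ((D : ℝ) * (2 + W) / 2)) := by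
  have hl2 : 0 < Real.log 2 := Real.log_pos (by norm_num)
  set τ := W / Real.log 2 with hτ
  have hτ0 : 0 < τ := by positivity
  obtain ⟨x, hx1, hx⟩ := exists_mul_pow_le_exp c (τ * (D / 2 + 1) + 2) (by positivity) τ hτ0.le D
  set b := τ * x + (τ * (D / 2 + 1) + 2) with hb
  have hb0 : 0 < b := by positivity
  refine ⟨2 * Real.exp (W * x) * b ^ D, by positivity, fun u hu hu1 => ?_⟩
  have hlu : Real.log u ≤ 0 := Real.log_nonpos hu.le hu1
  set L := 1 - Real.log u with hL
  have hL1 : 1 ≤ L := by linarith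
  have hL0 : 0 < L := by linarith
  have hlL0 : 0 ≤ Real.log L := Real.log_nonneg hL1
  have hlL : Real.log L ≤ L - 1 := Real.log_le_sub_one_of_pos hL0
  -- As `2^(-K/W) = exp(-K/τ) ≤ exp(-θ)`, the term `-log u` gives the accuracy, `(D/2) log L`
  -- cancels the factor `(K+1)^D` of the squared error, and `x` absorbs constants.
  set θ := x + D / 2 * Real.log L - Real.log u with hθ
  have hθ0 : 0 ≤ θ := by
    have : 0 ≤ (D : ℝ) / 2 * Real.log L := by positivity
    linarith
  set K := ⌈τ * θ⌉₊ with hK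
  have hK1 : τ * θ ≤ K := Nat.le_ceil _
  have hK2 : (K : ℝ) < τ * θ + 1 := Nat.ceil_lt_add_one (by positivity)
  have hKb : (K : ℝ) + 1 ≤ b * L := by
    have h1 : θ ≤ (x + (D / 2 + 1)) * L := by
      have h2 : (D : ℝ) / 2 * Real.log L ≤ D / 2 * L := by gcongr; linarith
      have h3 : x ≤ x * L := le_mul_of_one_le_right (by linarith) hL1
      rw [hθ, add_mul, add_mul]
      linarith
    have h4 : τ * θ ≤ τ * ((x + (D / 2 + 1)) * L) := by gcongr
    have h5 : b * L = τ * ((x + (D / 2 + 1)) * L) + 2 * L := by rw [hb]; ring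
    linarith
  have hKD : ((K : ℝ) + 1) ^ D ≤ b ^ D * L ^ D := by
    rw [← mul_pow]; gcongr
  have hLD : Real.exp (D * Real.log L) = L ^ D := by
    rw [mul_comm, Real.exp_mul, Real.exp_log hL0, Real.rpow_natCast]
  refine ⟨K, ?_, ?_⟩
  · have hs : (((2 : ℝ) ^ (-1 / W)) ^ K) ^ 2 = Real.exp (-(2 * (K / τ))) := by
      rw [Real.rpow_def_of_pos (by norm_num), ← Real.exp_nat_mul, ← Real.exp_nat_mul]
      congr 1
      rw [hτ]
      push_cast
      field_simp
    have hs2 : Real.exp (-(2 * (K / τ))) ≤ Real.exp (-(2 * θ)) := by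
      refine Real.exp_le_exp.2 ?_
      have : θ ≤ K / τ := by rw [le_div_iff₀ hτ0]; linarith
      linarith
    have hs3 : Real.exp (-(2 * θ)) * (Real.exp (2 * x) * L ^ D) = u ^ 2 := by
      rw [← hLD, ← Real.exp_add, ← Real.exp_add,
        show -(2 * θ) + (2 * x + D * Real.log L) = (2 : ℕ) * Real.log u by
          rw [hθ]; push_cast; ring, Real.exp_nat_mul, Real.exp_log hu]
    rw [hs]
    calc c * ((K : ℝ) + 1) ^ D * Real.exp (-(2 * (K / τ)))
        ≤ c * (b ^ D * L ^ D) * Real.exp (-(2 * θ)) := by gcongr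
      _ = (c * b ^ D) * (L ^ D * Real.exp (-(2 * θ))) := by ring
      _ ≤ Real.exp (2 * x) * (L ^ D * Real.exp (-(2 * θ))) := by gcongr
      _ = u ^ 2 := by rw [← hs3]; ring
  · have h2K : (2 : ℝ) ^ K = Real.exp (K * Real.log 2) := by
      rw [mul_comm, Real.exp_mul, Real.exp_log (by norm_num), Real.rpow_natCast]
    have h2K2 : (2 : ℝ) ^ K ≤ 2 * Real.exp (W * θ) := by
      have h3 : (K : ℝ) * Real.log 2 ≤ Real.log 2 + W * θ := by
        have : τ * θ * Real.log 2 = W * θ := by rw [hτ]; field_simp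
        nlinarith
      rw [h2K]
      refine (Real.exp_le_exp.2 h3).trans ?_
      rw [Real.exp_add, Real.exp_log (by norm_num)]
    have hθe : Real.exp (W * θ) = Real.exp (W * x) * (L ^ ((D : ℝ) * W / 2) * u ^ (-W)) := by
      rw [Real.rpow_def_of_pos hL0, Real.rpow_def_of_pos hu, ← Real.exp_add, ← Real.exp_add, hθ]
      congr 1
      ring
    have hLe : L ^ ((D : ℝ) * (2 + W) / 2) = L ^ ((D : ℝ) * W / 2) * L ^ D := by
      rw [← Real.rpow_natCast, ← Real.rpow_add hL0]
      congr 1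
      ring
    calc (2 : ℝ) ^ K * ((K : ℝ) + 1) ^ D ≤ (2 * Real.exp (W * θ)) * (b ^ D * L ^ D) := by gcongr
      _ = _ := by rw [hθe, hLe]; ring

theorem norm_starProjection_orthogonal_le {E : Type*} [NormedAddCommGroup E]
    [InnerProductSpace ℝ E] [FiniteDimensional ℝ E] {𝒱 : Submodule ℝ E} (x : E) {g : E}
    (hg : g ∈ 𝒱) : ‖𝒱ᗮ.starProjection x‖ ≤ ‖x - g‖ := by
  have h1 : 𝒱ᗮ.starProjection x = 𝒱ᗮ.starProjection (x - g) := by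
    rw [map_sub, Submodule.starProjection_orthogonal_apply_eq_zero hg, sub_zero]
  rw [h1]
  exact 𝒱ᗮ.norm_starProjection_apply_le _

/-- A sequence of subspaces shifted by one, starting with `⊥`. -/
def prependBot {E : Type*} [AddCommGroup E] [Module ℝ E] (V : ℕ → Submodule ℝ E) :
    ℕ → Submodule ℝ E
  | 0 => ⊥
  | n + 1 => V n

theorem exists_subspace_tensorPower (D q : ℕ) {γ W : ℝ} (hq : 1 ≤ q) (hW : 0 < W) :
    ∃ C : ℝ, 0 < C ∧ ∀ (m r : ℕ) (Ψ : Matrix (Fin m) (Fin r) ℝ), (∀ j, ‖column Ψ j‖ ≤ 1) →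
      (∃ 𝒱, IsNestedApproximation 𝒱 Ψ q γ W) → ∀ u : ℝ, 0 < u → u ≤ 1 →
      ∃ 𝒱 : Submodule ℝ (EuclideanSpace ℝ (Fin (D + 1) → Fin m)),
        (Module.finrank ℝ 𝒱 : ℝ) ≤
          C * (u ^ (-W) * (1 - Real.log u) ^ ((D : ℝ) * (2 + W) / 2)) ∧
        ∀ j, ∃ g ∈ 𝒱, ‖column (tensorPower (D + 1) Ψ) j - g‖ ≤ u := by
  set s : ℝ := (2 : ℝ) ^ (-1 / W) with hs
  have hs0 : 0 < s := by positivity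
  have hs1 : s ≤ 1 := Real.rpow_le_one_of_one_le_of_nonpos (by norm_num)
    (div_nonpos_of_nonpos_of_nonneg (by norm_num) hW.le)
  set g := max 1 γ with hg
  have hg1 : 1 ≤ g := le_max_left _ _
  -- Prepending `⊥` shifts the levels by one; dividing by `s` compensates. Indices 0 and 1 of the
  -- shifted sequence, where no approximation bound is given, are covered by the unit norm of the
  -- columns.
  set G := g / s with hG
  have hGs : G * s = g := by rw [hG]; field_simp
  have hG1 : 1 ≤ G := by rw [hG, one_le_div hs0]; linarith
  obtain ⟨C, hC, hlev⟩ := exists_level hW D (c := (8 * G ^ 2) ^ (D + 1)) (by positivity)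
  have hq0 : (0 : ℝ) < q := by exact_mod_cast hq
  refine ⟨q ^ (D + 1) * C, by positivity, ?_⟩
  rintro m r Ψ hΨ ⟨V, hV⟩ u hu hu1
  have hmono : Monotone (prependBot V) := monotone_nat_of_le_succ fun n => by
    cases n with
    | zero => exact bot_le
    | succ n => exact hV.nested n
  have hsub : ∀ (𝒱 : Submodule ℝ (EuclideanSpace ℝ (Fin m))) (x : EuclideanSpace ℝ (Fin m)),
      x - 𝒱.starProjection x = 𝒱ᗮ.starProjection x := fun 𝒱 x =>
    sub_eq_of_eq_add' (𝒱.starProjection_add_starProjection_orthogonal x).symm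
  have happ : ∀ j n, ‖column Ψ j - (prependBot V n).starProjection (column Ψ j)‖ ≤ G * s ^ n := by
    intro j n
    have hle1 : ‖column Ψ j - (prependBot V n).starProjection (column Ψ j)‖ ≤ 1 := by
      rw [hsub]
      exact ((prependBot V n)ᗮ.norm_starProjection_apply_le _).trans (hΨ j)
    rcases n with _ | _ | n
    · exact hle1.trans (hG1.trans_eq (by simp))
    · exact hle1.trans (by rw [zero_add, pow_one, hGs]; exact hg1)
    · change ‖column Ψ j - (V (n + 1)).starProjection (column Ψ j)‖ ≤ _
      have h1 : ‖(V (n + 1))ᗮ.starProjection (column Ψ j)‖ ≤ approximationNumber (V (n + 1)) Ψ :=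
        le_ciSup (f := fun j => ‖(V (n + 1))ᗮ.starProjection (column Ψ j)‖)
          (Set.finite_range _).bddAbove j
      have h2 := hV.approx (n + 1) (by omega)
      have h3 : (2 : ℝ) ^ (-((n + 1 : ℕ) : ℝ) / W) = s ^ (n + 1) := by
        rw [hs, ← Real.rpow_natCast, ← Real.rpow_mul (by norm_num)]
        congr 1
        ring
      rw [h3] at h2
      rw [hsub]
      refine h1.trans (h2.trans ?_)
      calc γ * s ^ (n + 1) ≤ g * s ^ (n + 1) := by gcongr; exact le_max_right _ _
        _ = G * s ^ (n + 2) := by rw [← hGs]; ring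
  obtain ⟨U, hU⟩ := exists_hyperbolicCross (V := prependBot V) hmono rfl (q := q) hV.finrank_le Ψ hΨ hG1
    hs0.le hs1 happ D
  obtain ⟨K, hK1, hK2⟩ := hlev u hu hu1
  refine ⟨U K, ?_, fun j => ?_⟩
  · have h1 : (Module.finrank ℝ (U K) : ℝ) ≤ q ^ (D + 1) * 2 ^ K * (K + 1) ^ D := by
      exact_mod_cast (hU K).1
    calc _ ≤ _ := h1
      _ = (q : ℝ) ^ (D + 1) * (2 ^ K * ((K : ℝ) + 1) ^ D) := by ring
      _ ≤ _ := by rw [mul_assoc]; gcongr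
  · obtain ⟨a, ha, hle⟩ := (hU K).2 j
    exact ⟨a, ha, le_of_sq_le_sq (hle.trans hK1) hu.le⟩

/-! ### From subspaces and nets to `epsApproximation`, covering numbers and entropy. -/

theorem epsApproximation_le {ι κ : Type*} [Fintype ι] {ε : ℝ} (hε : 0 ≤ ε) (X : Matrix ι κ ℝ)
    (𝒱 : Submodule ℝ (EuclideanSpace ℝ ι))
    (h : ∀ j, ‖𝒱ᗮ.starProjection (column X j)‖ ≤ ε) :
    epsApproximation ε X ≤ max 1 (Module.finrank ℝ 𝒱) := by
  rcases Nat.eq_zero_or_pos (Module.finrank ℝ 𝒱) with h0 | hpos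
  · have hbot : 𝒱 = ⊥ := Submodule.finrank_eq_zero.1 h0
    refine le_trans ?_ (le_max_left _ _)
    -- Dimension 0 is not admissible, but here every column has norm at most `ε`, so any line
    -- serves. In a trivial ambient space no dimension is admissible and the infimum of the empty
    -- set is 0.
    by_cases hne : ∃ v : EuclideanSpace ℝ ι, v ≠ 0
    · obtain ⟨v, hv⟩ := hne
      refine Nat.sInf_le ⟨le_rfl, Submodule.span ℝ {v}, finrank_span_singleton hv, ?_⟩
      refine Real.iSup_le (fun j => ?_) hε
      refine (Submodule.norm_starProjection_apply_le _ _).trans ?_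
      have h2 : 𝒱ᗮ.starProjection (column X j) = column X j :=
        Submodule.starProjection_eq_self_iff.2 (by simp [hbot])
      exact h2 ▸ h j
    · push Not at hne
      have : {N | 1 ≤ N ∧ ∃ 𝒱 : Submodule ℝ (EuclideanSpace ℝ ι),
          Module.finrank ℝ 𝒱 = N ∧ approximationNumber 𝒱 X ≤ ε} = ∅ := by
        refine Set.eq_empty_of_forall_notMem ?_
        rintro N ⟨hN, W, hW, -⟩
        have : W = ⊥ := (Submodule.eq_bot_iff _).2 fun x _ => hne x
        rw [this, finrank_bot] at hW
        omega
      rw [epsApproximation, this, Nat.sInf_empty]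
      exact Nat.zero_le _
  · refine le_trans (Nat.sInf_le ⟨hpos, 𝒱, rfl, ?_⟩) (le_max_right _ _)
    exact Real.iSup_le h hε

/-- A covering estimate for `d`-fold tensor powers from one for the factor. -/
theorem exists_net_tensorPower {m r : ℕ} {Ψ : Matrix (Fin m) (Fin r) ℝ}
    (hΨ : ∀ j, ‖column Ψ j‖ ≤ 1) (d : ℕ) {δ B : ℝ} (hδ : 0 ≤ δ) (hB : 0 ≤ B)
    (h : coveringNumber δ (columnSet Ψ) ≤ ENNReal.ofReal B) :
    ∃ S : Finset (Fin d → Fin r), (S.card : ℝ) ≤ B ^ d ∧ ∀ j, ∃ i ∈ S,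
      dist (column (tensorPower d Ψ) j) (column (tensorPower d Ψ) i) ≤ d * (2 * δ) := by
  obtain ⟨S, hS, hnet⟩ := exists_net_of_coveringNumber_le hδ hB (column Ψ) h
  refine ⟨Fintype.piFinset fun _ => S, ?_, fun j => ?_⟩
  · rw [Fintype.card_piFinset]
    simp only [Finset.prod_const, Finset.card_univ, Fintype.card_fin, Nat.cast_pow]
    gcongr
  · choose p hp hd using hnet
    exact ⟨fun k => p (j k), Fintype.mem_piFinset.2 fun k => hp _,
      dist_column_tensorPower_le hΨ d _ _ fun k => hd _⟩

theorem exists_eq_sum_of_mem_absconv {ι κ : Type*} [Fintype ι] [Fintype κ] (X : Matrix ι κ ℝ)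
    {f : EuclideanSpace ℝ ι} (hf : f ∈ absconv X) :
    ∃ β : κ → ℝ, ∑ j, |β j| ≤ 1 ∧ f = ∑ j, β j • column X j := by
  obtain ⟨β, hβ, rfl⟩ := hf
  refine ⟨β, hβ, ?_⟩
  ext i
  simp [Matrix.mulVec, dotProduct, column, mul_comm]

theorem entropy_le_of_finset {E : Type*} [PseudoMetricSpace E] {ε B : ℝ} (hε : 0 ≤ ε)
    {T : Set E} (N : Finset E) (hN : (N.card : ℝ) ≤ Real.exp B)
    (h : ∀ x ∈ T, ∃ c ∈ N, dist x c ≤ ε) : entropy ε T ≤ (B : EReal) := by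
  have h1 := ENNReal.log_le_log (coveringNumber_le_of_finset hε N hN h)
  rwa [ENNReal.log_ofReal_of_pos (Real.exp_pos _), Real.log_exp] at h1

/-! ### Recursion over scales, rates and the entropy of the hull. -/

/-- Summation of a one-step entropy recursion along a geometric scale. -/
theorem entropy_recursion {R : ℝ → ℝ → Prop} {F : ℝ → ℝ} {C θ : ℝ} (hC : 0 ≤ C) (hθ0 : 0 ≤ θ)
    (hθ : θ < 1) (hF : ∀ ε, 0 < ε → ε ≤ 1 → 0 ≤ F ε)
    (hmono : ∀ ε b b', b ≤ b' → R ε b → R ε b') (h1 : ∀ ε, 1 ≤ ε → R ε 0)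
    (hstep : ∀ ε b, 0 < ε → ε ≤ 1 → R (3 / 2 * ε) b → R ε (b + C * F ε))
    (hdec : ∀ ε, 0 < ε → 3 / 2 * ε ≤ 1 → F (3 / 2 * ε) ≤ θ * F ε)
    {ε : ℝ} (hε : 0 < ε) (hε1 : ε ≤ 1) : R ε (C / (1 - θ) * F ε) := by
  have h1θ : 0 < 1 - θ := by linarith
  -- The constant is the fixed point of `a ↦ a * θ + C`, so it is reproduced at each scale.
  have hCθ : C / (1 - θ) * θ + C = C / (1 - θ) := by field_simp; ring
  have hCn : 0 ≤ C / (1 - θ) := by positivity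
  have main : ∀ n : ℕ, ∀ ε, (2 / 3 : ℝ) ^ n ≤ ε → ε ≤ 1 → R ε (C / (1 - θ) * F ε) := by
    intro n
    induction n with
    | zero =>
      intro ε h0 h01
      have hε : 0 < ε := by simp at h0; linarith
      refine hmono _ _ _ ?_ (hstep ε 0 hε h01 (h1 _ (by simp at h0; linarith)))
      have := hF ε hε h01
      rw [zero_add, ← hCθ]
      nlinarith [mul_nonneg hCn hθ0]
    | succ n ih =>
      intro ε h0 h01
      have hε : 0 < ε := lt_of_lt_of_le (by positivity) h0
      have hFε := hF ε hε h01
      rcases le_total (3 / 2 * ε) 1 with h | h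
      · have h2 := ih (3 / 2 * ε) (by rw [pow_succ] at h0; linarith) h
        refine hmono _ _ _ ?_ (hstep ε _ hε h01 h2)
        have h3 := mul_le_mul_of_nonneg_left (hdec ε hε h) hCn
        calc _ ≤ C / (1 - θ) * (θ * F ε) + C * F ε := by linarith
          _ = (C / (1 - θ) * θ + C) * F ε := by ring
          _ = _ := by rw [hCθ]
      · refine hmono _ _ _ ?_ (hstep ε 0 hε h01 (h1 _ h))
        rw [zero_add, ← hCθ]
        nlinarith [mul_nonneg hCn hθ0]
  obtain ⟨n, hn⟩ := exists_pow_lt_of_lt_one hε (show (2 / 3 : ℝ) < 1 by norm_num)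
  exact main n ε hn.le hε1

/-- The rate `ε ^ (-2W / (2 + W)) * (1 + log (1 / ε)) ^ (D + W / (2 + W))`. -/
def entropyRate (W : ℝ) (D : ℕ) (ε : ℝ) : ℝ :=
  ε ^ (-(2 * W / (2 + W))) * (1 - Real.log ε) ^ ((D : ℝ) + W / (2 + W))

/-- The approximation accuracy that balances the two parts of the entropy bound. -/
def balancedAccuracy (W : ℝ) (D : ℕ) (ε : ℝ) : ℝ :=
  ε ^ (2 / (2 + W)) * (1 - Real.log ε) ^ ((D : ℝ) / 2 - 1 / (2 + W))

section Rates

variable {W : ℝ} {D : ℕ} {ε : ℝ}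

theorem one_le_one_sub_log (hε : 0 < ε) (hε1 : ε ≤ 1) : 1 ≤ 1 - Real.log ε := by
  linarith [Real.log_nonpos hε.le hε1]

theorem entropyRate_nonneg (hε : 0 < ε) (hε1 : ε ≤ 1) : 0 ≤ entropyRate W D ε := by
  have := one_le_one_sub_log hε hε1
  unfold entropyRate
  positivity

theorem balancedAccuracy_pos (hε : 0 < ε) (hε1 : ε ≤ 1) : 0 < balancedAccuracy W D ε := by
  have : 0 < 1 - Real.log ε := by linarith [one_le_one_sub_log hε hε1]
  unfold balancedAccuracy
  positivity

/-- Allows the logarithm of the accuracy to be replaced by that of the radius. For `D = 0` the log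
factor in the accuracy has a negative exponent, which `log L ≤ L - 1` controls. -/
theorem one_sub_log_balancedAccuracy_le (hW : 0 < W) (hε : 0 < ε) (hε1 : ε ≤ 1) :
    1 - Real.log (balancedAccuracy W D ε) ≤ 2 * (1 - Real.log ε) := by
  have hL1 := one_le_one_sub_log hε hε1
  set L := 1 - Real.log ε with hL
  have hL0 : 0 < L := by linarith
  have hlL0 : 0 ≤ Real.log L := Real.log_nonneg hL1
  have hlL : Real.log L ≤ L - 1 := Real.log_le_sub_one_of_pos hL0
  have hw : 1 / (2 + W) ≤ 1 / 2 := one_div_le_one_div_of_le (by norm_num) (by linarith)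
  have hw0 : 0 < 1 / (2 + W) := by positivity
  have hlog : Real.log (balancedAccuracy W D ε) =
      2 * (1 / (2 + W)) * (1 - L) + (D / 2 - 1 / (2 + W)) * Real.log L := by
    unfold balancedAccuracy
    rw [← hL, Real.log_mul (by positivity) (by positivity), Real.log_rpow hε, Real.log_rpow hL0, hL]
    ring
  have hD : 0 ≤ (D : ℝ) / 2 * Real.log L := by positivity
  rw [hlog]
  nlinarith [mul_nonneg hw0.le (sub_nonneg.2 hlL), mul_nonneg (sub_nonneg.2 hw) (sub_nonneg.2 hL1)]

/-- The dimension cost; `balancedAccuracy_sq_mul` gives the matching Maurey cost. -/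
theorem balancedAccuracy_rpow_mul (hW : 0 < W) (hε : 0 < ε) (hε1 : ε ≤ 1) :
    balancedAccuracy W D ε ^ (-W) * (1 - Real.log ε) ^ ((D : ℝ) * (2 + W) / 2) =
      entropyRate W D ε := by
  have hL0 : 0 < 1 - Real.log ε := by linarith [one_le_one_sub_log hε hε1]
  unfold balancedAccuracy entropyRate
  rw [Real.mul_rpow (by positivity) (by positivity), ← Real.rpow_mul hε.le, ← Real.rpow_mul hL0.le,
    mul_assoc, ← Real.rpow_add hL0]
  congr 2
  · field_simp
  · field_simp
    ring

theorem balancedAccuracy_sq_mul (hW : 0 < W) (hε : 0 < ε) (hε1 : ε ≤ 1) :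
    balancedAccuracy W D ε ^ 2 * (1 - Real.log ε) = ε ^ 2 * entropyRate W D ε := by
  have hL0 : 0 < 1 - Real.log ε := by linarith [one_le_one_sub_log hε hε1]
  unfold balancedAccuracy entropyRate
  have h1 : ε ^ 2 * ε ^ (-(2 * W / (2 + W))) = (ε ^ (2 / (2 + W))) ^ 2 := by
    rw [← Real.rpow_natCast, ← Real.rpow_natCast, ← Real.rpow_mul hε.le, ← Real.rpow_add hε]
    congr 1
    push_cast
    field_simp
    ring
  have h2 : (1 - Real.log ε) ^ ((D : ℝ) + W / (2 + W)) =
      ((1 - Real.log ε) ^ ((D : ℝ) / 2 - 1 / (2 + W))) ^ 2 * (1 - Real.log ε) := by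
    rw [← Real.rpow_natCast, ← Real.rpow_mul hL0.le, ← Real.rpow_add_one hL0.ne']
    congr 1
    push_cast
    field_simp
    ring
  rw [← mul_assoc, h1, h2]
  ring

/-- Pays for rounding the number of Maurey terms up to a positive integer. -/
theorem one_sub_log_le_entropyRate (hW : 0 < W) (hε : 0 < ε) (hε1 : ε ≤ 1) :
    1 - Real.log ε ≤ (1 + (2 + W) / (2 * W)) * entropyRate W D ε := by
  have hL1 := one_le_one_sub_log hε hε1
  have ha : 0 < 2 * W / (2 + W) := by positivity
  have h1 := Real.log_le_rpow_div (x := ε⁻¹) (by positivity) ha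
  rw [Real.log_inv, Real.inv_rpow hε.le, ← Real.rpow_neg hε.le] at h1
  have h2 : 1 ≤ ε ^ (-(2 * W / (2 + W))) :=
    Real.one_le_rpow_of_pos_of_le_one_of_nonpos hε hε1 (by linarith)
  have h3 : 1 ≤ (1 - Real.log ε) ^ ((D : ℝ) + W / (2 + W)) :=
    Real.one_le_rpow hL1 (by positivity)
  have h4 : ε ^ (-(2 * W / (2 + W))) ≤ entropyRate W D ε :=
    le_mul_of_one_le_right (by positivity) h3
  calc 1 - Real.log ε ≤ (1 + (2 + W) / (2 * W)) * ε ^ (-(2 * W / (2 + W))) := by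
        have : ε ^ (-(2 * W / (2 + W))) / (2 * W / (2 + W)) =
            (2 + W) / (2 * W) * ε ^ (-(2 * W / (2 + W))) := by field_simp
        rw [this] at h1
        linarith
    _ ≤ _ := by gcongr

theorem entropyRate_mul_le (hW : 0 < W) (hε : 0 < ε) (hε1 : 3 / 2 * ε ≤ 1) :
    entropyRate W D (3 / 2 * ε) ≤ (3 / 2 : ℝ) ^ (-(2 * W / (2 + W))) * entropyRate W D ε := by
  have hL1 := one_le_one_sub_log (by positivity) hε1
  have hlog : Real.log ε ≤ Real.log (3 / 2 * ε) := Real.log_le_log hε (by linarith)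
  unfold entropyRate
  rw [Real.mul_rpow (by norm_num) hε.le, mul_assoc]
  have h0 : 0 ≤ (D : ℝ) + W / (2 + W) := by positivity
  gcongr

end Rates

/-- Entropy of an absolute convex hull from approximation numbers and the covering numbers of the
extreme points. -/
theorem exists_cover_absconv {W : ℝ} (hW : 0 < W) (D : ℕ) {C₁ C₂ : ℝ} (hC₁ : 0 < C₁)
    (hC₂ : 0 ≤ C₂) : ∃ C : ℝ, 0 < C ∧ ∀ (J E : Type) [Fintype J] [NormedAddCommGroup E]
      [InnerProductSpace ℝ E] [FiniteDimensional ℝ E] (v : J → E), (∀ j, ‖v j‖ ≤ 1) →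
      (∀ u : ℝ, 0 < u → u ≤ 1 → ∃ 𝒱 : Submodule ℝ E,
        (Module.finrank ℝ 𝒱 : ℝ) ≤
          C₁ * (u ^ (-W) * (1 - Real.log u) ^ ((D : ℝ) * (2 + W) / 2)) ∧
        ∀ j, ∃ g ∈ 𝒱, ‖v j - g‖ ≤ u) →
      (∀ ε : ℝ, 0 < ε → ε ≤ 1 → ∃ S : Finset J,
        Real.log (2 * S.card + 1) ≤ C₂ * (1 - Real.log ε) ∧
        ∀ j, ∃ i ∈ S, dist (v j) (v i) ≤ ε / 8) →
      ∀ ε : ℝ, 0 < ε → ε ≤ 1 → ∃ N : Finset E,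
        (N.card : ℝ) ≤ Real.exp (C * entropyRate W D ε) ∧
        ∀ β : J → ℝ, ∑ j, |β j| ≤ 1 → ∃ c ∈ N, dist (∑ j, β j • v j) c ≤ ε := by
  set e : ℝ := (D : ℝ) * (2 + W) / 2 with he
  have he0 : 0 ≤ e := by positivity
  have hlog5 : 0 < Real.log 5 := Real.log_pos (by norm_num)
  set C₃ := Real.log 5 * (C₁ * 2 ^ e) + C₂ * (256 + 2 * (1 + (2 + W) / (2 * W))) with hC₃
  have hC₃0 : 0 < C₃ := by positivity
  set θ : ℝ := (3 / 2 : ℝ) ^ (-(2 * W / (2 + W))) with hθ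
  have hθ0 : 0 < θ := by positivity
  have hθ1 : θ < 1 := Real.rpow_lt_one_of_one_lt_of_neg (by norm_num) (by
    have : 0 < 2 * W / (2 + W) := by positivity
    linarith)
  refine ⟨C₃ / (1 - θ), div_pos hC₃0 (by linarith), ?_⟩
  intro J E _ _ _ _ v hv hM hS ε hε hε1
  refine entropy_recursion
    (R := fun ε b => ∃ N : Finset E, (N.card : ℝ) ≤ Real.exp b ∧
      ∀ β : J → ℝ, ∑ j, |β j| ≤ 1 → ∃ c ∈ N, dist (∑ j, β j • v j) c ≤ ε)
    (F := entropyRate W D) hC₃0.le hθ0.le hθ1 (fun ε => entropyRate_nonneg) ?_ ?_ ?_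
    (fun ε => entropyRate_mul_le hW) hε hε1
  · rintro ε b b' hb ⟨N, hN, h⟩
    exact ⟨N, hN.trans (Real.exp_le_exp.2 hb), h⟩
  · intro ε hε
    refine ⟨{0}, by simp, fun β hβ => ⟨0, by simp, ?_⟩⟩
    rw [dist_zero_right]
    exact (norm_sum_smul_le zero_le_one hv hβ).trans hε
  · rintro ε b hε hε1 ⟨N₀, hN₀, hcov⟩
    obtain ⟨S, hSc, hSn⟩ := hS ε hε hε1
    have hL1 := one_le_one_sub_log hε hε1
    set L := 1 - Real.log ε with hL
    have hF0 : 0 ≤ entropyRate W D ε := entropyRate_nonneg hε hε1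
    set u := balancedAccuracy W D ε with hu
    have hu0 : 0 < u := balancedAccuracy_pos hε hε1
    have hsub : ∃ 𝒱 : Submodule ℝ E, (Module.finrank ℝ 𝒱 : ℝ) ≤ C₁ * 2 ^ e * entropyRate W D ε ∧
        ∀ j, ∃ g ∈ 𝒱, ‖v j - g‖ ≤ u := by
      -- The approximation hypothesis covers only accuracies up to 1; beyond that the zero subspace
      -- suffices.
      rcases le_total u 1 with hu1 | hu1
      · obtain ⟨𝒱, hd, hg⟩ := hM u hu0 hu1
        refine ⟨𝒱, hd.trans ?_, hg⟩
        rw [← balancedAccuracy_rpow_mul hW hε hε1, ← hu, mul_assoc]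
        have h1 := one_sub_log_balancedAccuracy_le (D := D) hW hε hε1
        have h2 := one_le_one_sub_log hu0 hu1
        have h3 : (1 - Real.log u) ^ e ≤ 2 ^ e * L ^ e := by
          rw [← Real.mul_rpow (by norm_num) (by linarith)]
          exact Real.rpow_le_rpow (by linarith) h1 he0
        calc C₁ * (u ^ (-W) * (1 - Real.log u) ^ e) ≤ C₁ * (u ^ (-W) * (2 ^ e * L ^ e)) := by
              gcongr
          _ = _ := by ring
      · refine ⟨⊥, ?_, fun j => ⟨0, by simp, by simpa using (hv j).trans hu1⟩⟩
        rw [finrank_bot, Nat.cast_zero]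
        positivity
    obtain ⟨𝒱, hdim, happ⟩ := hsub
    set k := ⌈(16 * u) ^ 2 / ε ^ 2⌉₊ + 1 with hk
    have hk1 : (16 * u) ^ 2 / ε ^ 2 ≤ k := by
      rw [hk]; push_cast
      linarith [Nat.le_ceil ((16 * u) ^ 2 / ε ^ 2)]
    have hk2 : (k : ℝ) ≤ (16 * u) ^ 2 / ε ^ 2 + 2 := by
      rw [hk]; push_cast
      linarith [Nat.ceil_lt_add_one (show 0 ≤ (16 * u) ^ 2 / ε ^ 2 by positivity)]
    obtain ⟨N, hN, hNcov⟩ := exists_finset_refine v 𝒱 hε hu0.le (fun j => by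
        obtain ⟨g, hg, hle⟩ := happ j
        exact (norm_starProjection_orthogonal_le _ hg).trans hle) S hSn (k := k) (by omega)
        ((div_le_iff₀ (by positivity)).1 hk1) N₀ hcov
    refine ⟨N, ?_, hNcov⟩
    have h5 : (5 : ℝ) ^ Module.finrank ℝ 𝒱 = Real.exp (Real.log 5 * Module.finrank ℝ 𝒱) := by
      rw [Real.exp_mul, Real.exp_log (by norm_num), Real.rpow_natCast]
    have hSk : (2 * (S.card : ℝ) + 1) ^ k = Real.exp (Real.log (2 * S.card + 1) * k) := by
      rw [Real.exp_mul, Real.exp_log (by positivity), Real.rpow_natCast]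
    have hkL : (k : ℝ) * L ≤ (256 + 2 * (1 + (2 + W) / (2 * W))) * entropyRate W D ε := by
      have h1 := balancedAccuracy_sq_mul (D := D) hW hε hε1
      have h2 := one_sub_log_le_entropyRate (D := D) hW hε hε1
      have h3 : (16 * u) ^ 2 / ε ^ 2 * L = 256 * entropyRate W D ε := by
        rw [div_mul_eq_mul_div, div_eq_iff (by positivity)]
        linear_combination 256 * h1
      have h4 : (k : ℝ) * L ≤ ((16 * u) ^ 2 / ε ^ 2 + 2) * L := by gcongr
      rw [add_mul, h3] at h4
      linarith
    have hexp : Real.log 5 * Module.finrank ℝ 𝒱 + Real.log (2 * S.card + 1) * k ≤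
        C₃ * entropyRate W D ε := by
      have h1 : Real.log (2 * S.card + 1) * k ≤ C₂ * L * k := by gcongr
      have h2 : C₂ * (k * L) ≤
        C₂ * ((256 + 2 * (1 + (2 + W) / (2 * W))) * entropyRate W D ε) := by gcongr
      have h3 : Real.log 5 * Module.finrank ℝ 𝒱 ≤
        Real.log 5 * (C₁ * 2 ^ e * entropyRate W D ε) := by gcongr
      rw [hC₃]
      linarith
    calc (N.card : ℝ) ≤ N₀.card * 5 ^ Module.finrank ℝ 𝒱 * (2 * S.card + 1) ^ k := by
          exact_mod_cast hN
      _ ≤ Real.exp b * 5 ^ Module.finrank ℝ 𝒱 * (2 * S.card + 1) ^ k := by gcongr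
      _ = Real.exp (b + (Real.log 5 * Module.finrank ℝ 𝒱 + Real.log (2 * S.card + 1) * k)) := by
          rw [h5, hSk, Real.exp_add, Real.exp_add]
          ring
      _ ≤ _ := Real.exp_le_exp.2 (by linarith)

/-! ### Assembly of the bounds for tensor powers. -/

/-- A net of polynomial size costs one logarithm per Maurey term; `|V|` accommodates negative `V`.
-/
theorem log_card_net_le {A V κ x ε : ℝ} {d : ℕ} (hA : 0 < A) (hκ : 0 < κ) (hε : 0 < ε)
    (hε1 : ε ≤ 1) (hx0 : 0 ≤ x) (hx : x ≤ (A * (κ * ε) ^ (-V)) ^ d) :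
    Real.log (2 * x + 1) ≤
      (Real.log (2 * (A * κ ^ (-V)) ^ d + 1) + d * |V|) * (1 - Real.log ε) := by
  have hlε := Real.log_nonpos hε.le hε1
  set B := (A * κ ^ (-V)) ^ d with hB
  have hB0 : 0 < B := by positivity
  have hp1 : 1 ≤ (ε ^ (-|V|)) ^ d :=
    one_le_pow₀ (Real.one_le_rpow_of_pos_of_le_one_of_nonpos hε hε1 (by simp))
  have hle : 2 * x + 1 ≤ (2 * B + 1) * (ε ^ (-|V|)) ^ d := by
    have h1 : (A * (κ * ε) ^ (-V)) ^ d ≤ B * (ε ^ (-|V|)) ^ d := by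
      rw [Real.mul_rpow hκ.le hε.le, ← mul_assoc, mul_pow]
      have : ε ^ (-V) ≤ ε ^ (-|V|) :=
        Real.rpow_le_rpow_of_exponent_ge hε hε1 (neg_le_neg (le_abs_self V))
      gcongr
    linarith
  have h2 := Real.log_le_log (by linarith) hle
  rw [Real.log_mul (by positivity) (by positivity), Real.log_pow, Real.log_rpow hε] at h2
  have h3 : 0 ≤ Real.log (2 * B + 1) := Real.log_nonneg (by linarith)
  have h4 : 0 ≤ (d : ℝ) * |V| := by positivity
  nlinarith

theorem exists_epsApproximation_bound (D q : ℕ) (hq : 1 ≤ q) (γ W : ℝ) (hW : 0 < W) :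
    ∃ C ε₀ : ℝ, 0 < C ∧ 0 < ε₀ ∧ ε₀ < 1 ∧
      ∀ (m r : ℕ) (Ψ : Matrix (Fin m) (Fin r) ℝ), (∀ j, ‖column Ψ j‖ ≤ 1) →
        (∃ 𝒱, IsNestedApproximation 𝒱 Ψ q γ W) →
        ∀ ε : ℝ, 0 < ε → ε ≤ ε₀ →
          (epsApproximation ε (tensorPower (D + 1) Ψ) : ℝ) ≤
            C * (ε ^ (-W) * Real.log (1 / ε) ^ ((D : ℝ) * (2 + W) / 2)) := by
  obtain ⟨C, hC, hsub⟩ := exists_subspace_tensorPower D q (γ := γ) hq hW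
  set e : ℝ := (D : ℝ) * (2 + W) / 2 with he
  have he0 : 0 ≤ e := by positivity
  -- Below `exp (-1)` one has `1 ≤ log (1/ε)`, hence `1 - log ε ≤ 2 log (1/ε)`; this is the source
  -- of `2 ^ e`. The summand 1 accounts for the minimal dimension.
  refine ⟨1 + C * 2 ^ e, Real.exp (-1), by positivity, Real.exp_pos _,
    Real.exp_lt_one_iff.2 (by norm_num), fun m r Ψ hΨ hN ε hε hε0 => ?_⟩
  have hε1 : ε ≤ 1 := hε0.trans (Real.exp_le_one_iff.2 (by norm_num))
  have hlog : Real.log ε ≤ -1 := (Real.log_le_iff_le_exp hε).2 hε0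
  have hlog1 : Real.log (1 / ε) = -Real.log ε := by rw [one_div, Real.log_inv]
  set L := Real.log (1 / ε) with hL
  have hL1 : 1 ≤ L := by linarith
  obtain ⟨𝒱, hd, hg⟩ := hsub m r Ψ hΨ hN ε hε hε1
  have h1 := epsApproximation_le hε.le (tensorPower (D + 1) Ψ) 𝒱 (fun j => by
    obtain ⟨g, hg, hle⟩ := hg j
    exact (norm_starProjection_orthogonal_le _ hg).trans hle)
  have h2 : (epsApproximation ε (tensorPower (D + 1) Ψ) : ℝ) ≤ 1 + Module.finrank ℝ 𝒱 := by
    exact_mod_cast h1.trans (max_le (by omega) (by omega))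
  have h3 : (1 - Real.log ε) ^ e ≤ 2 ^ e * L ^ e := by
    rw [← Real.mul_rpow (by norm_num) (by linarith)]
    exact Real.rpow_le_rpow (by linarith) (by linarith) he0
  have h4 : 1 ≤ ε ^ (-W) * L ^ e := one_le_mul_of_one_le_of_one_le
    (Real.one_le_rpow_of_pos_of_le_one_of_nonpos hε hε1 (by linarith)) (Real.one_le_rpow hL1 he0)
  calc _ ≤ _ := h2
    _ ≤ ε ^ (-W) * L ^ e + C * (ε ^ (-W) * (2 ^ e * L ^ e)) := by
        refine add_le_add h4 (hd.trans ?_)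
        gcongr
    _ = _ := by ring

theorem exists_covering_and_entropy_bound (D q : ℕ) (hq : 1 ≤ q) (γ W : ℝ) (hW : 0 < W)
    (V A ε₁ : ℝ) (hA : 0 < A) (hε₁ : 0 < ε₁) :
    ∃ C ε₀ : ℝ, 0 < C ∧ 0 < ε₀ ∧ ε₀ < 1 ∧
      ∀ (m r : ℕ) (Ψ : Matrix (Fin m) (Fin r) ℝ), (∀ j, ‖column Ψ j‖ ≤ 1) →
        (∃ 𝒱, IsNestedApproximation 𝒱 Ψ q γ W) →
        (∀ ε : ℝ, 0 < ε → ε ≤ ε₁ →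
          coveringNumber ε (columnSet Ψ) ≤ ENNReal.ofReal (A * ε ^ (-V))) →
        ∀ ε : ℝ, 0 < ε → ε ≤ ε₀ →
          coveringNumber ε (columnSet (tensorPower (D + 1) Ψ)) ≤
            ENNReal.ofReal (C * ε ^ (-(((D + 1 : ℕ) : ℝ) * V))) ∧
          entropy ε (absconv (tensorPower (D + 1) Ψ)) ≤
            ((C * (ε ^ (-(2 * W / (2 + W))) * Real.log (1 / ε) ^ (D : ℝ) *
              Real.log (1 / ε) ^ (W / (2 + W))) : ℝ) : EReal) := by
  classical
  set d := D + 1 with hd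
  have hd0 : (0 : ℝ) < (d : ℝ) := by positivity
  have hd1 : (1 : ℝ) ≤ d := by exact_mod_cast (by omega : 1 ≤ d)
  obtain ⟨C₁, hC₁, hsub⟩ := exists_subspace_tensorPower D q (γ := γ) hq hW
  -- A net of `Ψ` at radius `κη` gives product-net error `d * (2κη) ≤ η/8`, and `κη ≤ ε₁` for all `η
  -- ≤ 1`.
  set κ := min (1 / (16 * d) : ℝ) ε₁ with hκ
  have hκ0 : 0 < κ := lt_min (by positivity) hε₁
  have hκd : d * (2 * κ) ≤ 1 / 8 := by
    have : κ ≤ 1 / (16 * d) := min_le_left _ _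
    rw [le_div_iff₀ (by positivity)] at this
    linarith
  set C₂ := Real.log (2 * (A * κ ^ (-V)) ^ d + 1) + d * |V| with hC₂
  have hC₂0 : 0 ≤ C₂ := by
    have : 0 ≤ Real.log (2 * (A * κ ^ (-V)) ^ d + 1) :=
      Real.log_nonneg (by linarith [show 0 < (A * κ ^ (-V)) ^ d by positivity])
    positivity
  obtain ⟨C₃, hC₃, hcover⟩ := exists_cover_absconv hW D hC₁ hC₂0
  set b : ℝ := (D : ℝ) + W / (2 + W) with hb
  have hb0 : 0 ≤ b := by positivity
  set C₄ := (A * (1 / (2 * d) : ℝ) ^ (-V)) ^ d with hC₄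
  have hC₄0 : 0 < C₄ := by positivity
  refine ⟨C₄ + C₃ * 2 ^ b, min (Real.exp (-1)) ε₁, by positivity, lt_min (Real.exp_pos _) hε₁,
    (min_le_left _ _).trans_lt (Real.exp_lt_one_iff.2 (by norm_num)), ?_⟩
  intro m r Ψ hΨ hN hcov ε hε hε0
  have hεe : ε ≤ Real.exp (-1) := hε0.trans (min_le_left _ _)
  have hε1 : ε ≤ 1 := hεe.trans (Real.exp_le_one_iff.2 (by norm_num))
  refine ⟨?_, ?_⟩
  -- The factor 2 pays for internal centres and `d` for the number of tensor factors.
  · set δ := 1 / (2 * d) * ε with hδ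
    have hδ0 : 0 < δ := by positivity
    have hδε : δ ≤ ε := by
      refine mul_le_of_le_one_left hε.le ?_
      rw [div_le_one (by positivity)]
      linarith
    obtain ⟨S, hS, hnet⟩ := exists_net_tensorPower hΨ d hδ0.le (by positivity)
      (hcov δ hδ0 (hδε.trans (hε0.trans (min_le_right _ _))))
    refine coveringNumber_le_of_finset hε.le (S.image (column (tensorPower d Ψ))) ?_ ?_
    · have h1 : ((S.image (column (tensorPower d Ψ))).card : ℝ) ≤ S.card := by
        exact_mod_cast Finset.card_image_le
      have h2 : (A * δ ^ (-V)) ^ d = C₄ * ε ^ (-((d : ℝ) * V)) := by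
        rw [hδ, Real.mul_rpow (by positivity) hε.le, ← mul_assoc, mul_pow,
          ← Real.rpow_mul_natCast hε.le]
        congr 2
        ring
      refine h1.trans (hS.trans ?_)
      rw [h2]
      have : 0 ≤ C₃ * 2 ^ b := by positivity
      gcongr
      linarith
    · rintro _ ⟨j, rfl⟩
      obtain ⟨i, hi, hle⟩ := hnet j
      refine ⟨_, Finset.mem_image_of_mem _ hi, hle.trans_eq ?_⟩
      rw [hδ]
      field_simp
  · have hlog : Real.log ε ≤ -1 := (Real.log_le_iff_le_exp hε).2 hεe
    have hlog1 : Real.log (1 / ε) = -Real.log ε := by rw [one_div, Real.log_inv]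
    obtain ⟨N, hN, hNc⟩ := hcover (Fin d → Fin r) (EuclideanSpace ℝ (Fin d → Fin m))
      (column (tensorPower d Ψ)) (norm_column_tensorPower_le hΨ d) (hsub m r Ψ hΨ hN)
      (fun η hη hη1 => by
        obtain ⟨S, hS, hnet⟩ := exists_net_tensorPower hΨ d (by positivity) (by positivity)
          (hcov (κ * η) (by positivity)
            ((mul_le_of_le_one_right hκ0.le hη1).trans (min_le_right _ _)))
        refine ⟨S, log_card_net_le hA hκ0 hη hη1 (Nat.cast_nonneg _) hS, fun j => ?_⟩
        obtain ⟨i, hi, hle⟩ := hnet j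
        refine ⟨i, hi, hle.trans ?_⟩
        nlinarith) ε hε hε1
    have hent := entropy_le_of_finset hε.le (T := absconv (tensorPower d Ψ)) N hN (fun f hf => by
      obtain ⟨β, hβ, rfl⟩ := exists_eq_sum_of_mem_absconv _ hf
      exact hNc β hβ)
    refine hent.trans (EReal.coe_le_coe_iff.2 ?_)
    set L := Real.log (1 / ε) with hL
    have hL1 : 1 ≤ L := by linarith
    have hL0 : 0 < L := by linarith
    have h3 : (1 - Real.log ε) ^ b ≤ 2 ^ b * L ^ b := by
      rw [← Real.mul_rpow (by norm_num) hL0.le]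
      exact Real.rpow_le_rpow (by linarith) (by linarith) hb0
    rw [mul_assoc (ε ^ _), ← Real.rpow_add hL0, ← hb]
    calc C₃ * entropyRate W D ε ≤ C₃ * (ε ^ (-(2 * W / (2 + W))) * (2 ^ b * L ^ b)) := by
          unfold entropyRate
          gcongr
      _ = C₃ * 2 ^ b * (ε ^ (-(2 * W / (2 + W))) * L ^ b) := by ring
      _ ≤ _ := by
          gcongr
          linarith

end TensorEntropy

end

theorem mainTheorem3 (d q : ℕ) (hd : 1 ≤ d) (hq : 1 ≤ q) (γ W : ℝ) (hγ : 0 < γ) (hW : 0 < W) :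
    (∃ C ε₀ : ℝ, 0 < C ∧ 0 < ε₀ ∧ ε₀ < 1 ∧
      ∀ (m r : ℕ) (Ψ : Matrix (Fin m) (Fin r) ℝ),
        (∀ j, ‖TensorEntropy.column Ψ j‖ ≤ 1) →
        (∃ 𝒱, TensorEntropy.IsNestedApproximation 𝒱 Ψ q γ W) →
        ∀ ε : ℝ, 0 < ε → ε ≤ ε₀ →
          (TensorEntropy.epsApproximation ε (TensorEntropy.tensorPower d Ψ) : ℝ) ≤
            C * (ε ^ (-W) * Real.log (1 / ε) ^ (((d : ℝ) - 1) * (2 + W) / 2))) ∧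
    (∀ V A ε₁ : ℝ, 0 < A → 0 < ε₁ →
      ∃ C ε₀ : ℝ, 0 < C ∧ 0 < ε₀ ∧ ε₀ < 1 ∧
        ∀ (m r : ℕ) (Ψ : Matrix (Fin m) (Fin r) ℝ),
          (∀ j, ‖TensorEntropy.column Ψ j‖ ≤ 1) →
          (∃ 𝒱, TensorEntropy.IsNestedApproximation 𝒱 Ψ q γ W) →
          (∀ ε : ℝ, 0 < ε → ε ≤ ε₁ →
            TensorEntropy.coveringNumber ε (TensorEntropy.columnSet Ψ) ≤
              ENNReal.ofReal (A * ε ^ (-V))) →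
          ∀ ε : ℝ, 0 < ε → ε ≤ ε₀ →
            TensorEntropy.coveringNumber ε
                (TensorEntropy.columnSet (TensorEntropy.tensorPower d Ψ)) ≤
              ENNReal.ofReal (C * ε ^ (-((d : ℝ) * V))) ∧
            TensorEntropy.entropy ε
                (TensorEntropy.absconv (TensorEntropy.tensorPower d Ψ)) ≤
              ((C * (ε ^ (-(2 * W / (2 + W))) * Real.log (1 / ε) ^ ((d : ℝ) - 1) *
                Real.log (1 / ε) ^ (W / (2 + W))) : ℝ) : EReal)) := by
  obtain ⟨D, rfl⟩ : ∃ D, d = D + 1 := ⟨d - 1, by omega⟩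
  have hD : ((D + 1 : ℕ) : ℝ) - 1 = D := by push_cast; ring
  rw [hD]
  exact ⟨TensorEntropy.exists_epsApproximation_bound D q hq γ W hW, fun V A ε₁ hA hε₁ =>
    TensorEntropy.exists_covering_and_entropy_bound D q hq γ W hW V A ε₁ hA hε₁⟩
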